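/- Let $q\ge 4$ be an integer, let $0<\epsilon\le \tfrac12$, and consider the typewriter channel with input and output alphabet $\mathbb{Z}_q$ and transition probabilities $W(y|x)=1-\epsilon$ if $y=x$, $W(y|x)=\epsilon$ if $y=x+1 \bmod q$, and $W(y|x)=0$ otherwise, used without memory. All logarithms are to base $2$. Let $\mathsf{P}_e(M,n)$ be the smallest possible average probability of error of codes with $M$ codewords of length $n$ (over all codes and decoders), and let $$E(R)=\limsup_{n\to\infty}\frac1n\log\frac{1}{\mathsf{P}_e(\lceil 2^{nR}\rceil,n)}\in[0,+\infty]$$ be the reliability function of the channel (with $\log\frac10=+\infty$). Put $\alpha_\epsilon=\sqrt{\epsilon(1-\epsilon)}$, let $h_2(x)=-x\log x-(1-x)\log(1-x)$ be the binary entropy function, and let $$\delta_{LP2}(R)=\min\; 2\,\frac{\alpha(1-\alpha)-\beta(1-\beta)}{1+2\sqrt{\beta(1-\beta)}}$$ be the second McEliece–Rodemich–Rumsey–Welch linear-programming bound for binary codes, where the minimum is over all $0\le\beta\le\alpha\le\tfrac12$ satisfying $1-h_2(\alpha)+h_2(\beta)\le R$. Then for every real $R>\log(q/2)$, $$E(R)\le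 \delta_{LP2}\bigl(R-\log(q/2)\bigr)\,\log\frac{1}{\alpha_\epsilon}.$$ -/

import Mathlib

namespace Typewriter

open Filter

noncomputable section

/-- Transition probabilities `W(y|x)` of the typewriter channel on `ℤ/qℤ` with crossover
probability `ε`: the input `x` is received as `x` with probability `1 - ε` and as `x + 1` with
probability `ε`. -/
def W (q : ℕ) (ε : ℝ) (x y : ZMod q) : ℝ :=
  if y = x then 1 - ε else if y = x + 1 then ε else 0

/-- The memoryless extension of the channel to words of length `n`. -/
def Wn (q : ℕ) (ε : ℝ) {n : ℕ} (x y : Fin n → ZMod q) : ℝ :=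
  ∏ i, W q ε (x i) (y i)

/-- Average probability of error of the code with codewords `c 0, …, c (M - 1)` of length `n`
when the decoder `dec` is used. -/
def avgError (q : ℕ) [NeZero q] (ε : ℝ) {M n : ℕ} (c : Fin M → Fin n → ZMod q)
    (dec : (Fin n → ZMod q) → Fin M) : ℝ :=
  (1 / (M : ℝ)) * ∑ m, ∑ y, if dec y = m then 0 else Wn q ε (c m) y

/-- `Pe(M, n)`: the smallest average probability of error of codes with `M` codewords of length
`n`, over all codes and all decoders (a minimum over a finite set, nonempty for `M ≥ 1`). -/
def minError (q : ℕ) [NeZero q] (ε : ℝ) (M n : ℕ) : ℝ :=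
  ⨅ p : (Fin M → Fin n → ZMod q) × ((Fin n → ZMod q) → Fin M), avgError q ε p.1 p.2

/-- For `M ≥ 1` the infimum in `minError` is a minimum. -/
theorem exists_avgError_eq_minError (q : ℕ) [NeZero q] (ε : ℝ) (M n : ℕ) (hM : 1 ≤ M) :
    ∃ (c : Fin M → Fin n → ZMod q) (dec : (Fin n → ZMod q) → Fin M),
      avgError q ε c dec = minError q ε M n := by
  have : Nonempty (Fin M) := ⟨⟨0, hM⟩⟩
  obtain ⟨p, hp⟩ := exists_eq_ciInf_of_finite
    (f := fun p : (Fin M → Fin n → ZMod q) × ((Fin n → ZMod q) → Fin M) =>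
      avgError q ε p.1 p.2)
  exact ⟨p.1, p.2, hp⟩

/-- `(1/n) log₂ (1/P)` as an extended real, equal to `+∞` when `P = 0`. -/
def exponent (P : ℝ) (n : ℕ) : EReal :=
  if P = 0 then ⊤ else (((1 / (n : ℝ)) * Real.logb 2 (1 / P) : ℝ) : EReal)

/-- The reliability function `E(R)`, with values in the extended reals. -/
def reliability (q : ℕ) [NeZero q] (ε R : ℝ) : EReal :=
  limsup (fun n : ℕ => exponent (minError q ε ⌈(2 : ℝ) ^ ((n : ℝ) * R)⌉₊ n) n) atTop

/-- The binary entropy function in bits. -/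
def h2 (x : ℝ) : ℝ := Real.binEntropy x / Real.log 2

/-- The pairs `(a, b)` with `0 ≤ b ≤ a ≤ 1/2` and `1 - h₂(a) + h₂(b) ≤ R`. -/
def lp2Region (R : ℝ) : Set (ℝ × ℝ) :=
  {p | 0 ≤ p.2 ∧ p.2 ≤ p.1 ∧ p.1 ≤ 1 / 2 ∧ 1 - h2 p.1 + h2 p.2 ≤ R}

/-- The function minimized in the second linear-programming bound. -/
def lp2Fun (p : ℝ × ℝ) : ℝ :=
  2 * (p.1 * (1 - p.1) - p.2 * (1 - p.2)) / (1 + 2 * √(p.2 * (1 - p.2)))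

/-- The second McEliece–Rodemich–Rumsey–Welch linear-programming bound on the relative minimum
distance of binary codes of rate `R`. -/
def deltaLP2 (R : ℝ) : ℝ := sInf (lp2Fun '' lp2Region R)

/-- For `R ≥ 0` the infimum in `deltaLP2` is a minimum. -/
theorem isLeast_deltaLP2 (R : ℝ) (hR : 0 ≤ R) :
    IsLeast (lp2Fun '' lp2Region R) (deltaLP2 R) := by
  have hc : Continuous h2 := Real.binEntropy_continuous.div_const _
  have hne : (lp2Region R).Nonempty := by
    refine ⟨(1 / 2, 0), le_refl _, by norm_num, le_refl _, ?_⟩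
    have hl : Real.log 2 ≠ 0 := (Real.log_pos one_lt_two).ne'
    have h1 : h2 (1 / 2) = 1 := by
      rw [h2, one_div, Real.binEntropy_two_inv, div_self hl]
    have h0 : h2 0 = 0 := by simp [h2]
    simp only [h1, h0]
    linarith
  have hcl : IsClosed (lp2Region R) := by
    refine (isClosed_le continuous_const continuous_snd).inter
      ((isClosed_le continuous_snd continuous_fst).inter
        ((isClosed_le continuous_fst continuous_const).inter ?_))
    exact isClosed_le ((continuous_const.sub (hc.comp continuous_fst)).add
      (hc.comp continuous_snd)) continuous_const
  have hcpt : IsCompact (lp2Region R) := by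
    refine IsCompact.of_isClosed_subset
      ((isCompact_Icc (a := (0 : ℝ)) (b := 1 / 2)).prod
        (isCompact_Icc (a := (0 : ℝ)) (b := 1 / 2))) hcl ?_
    rintro ⟨a, b⟩ ⟨h1, h2, h3, -⟩
    simp only at h1 h2 h3
    exact ⟨⟨h1.trans h2, h3⟩, ⟨h1, h2.trans h3⟩⟩
  have hf : Continuous lp2Fun := by
    unfold lp2Fun
    refine Continuous.div (by fun_prop) (by fun_prop) (fun p => ?_)
    have := Real.sqrt_nonneg (p.2 * (1 - p.2))
    linarith
  exact (hcpt.image hf).isLeast_sInf (hne.image _)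

/-- `α_ε = √(ε (1 - ε))`. -/
def alphaEps (ε : ℝ) : ℝ := √(ε * (1 - ε))

end

end Typewriter

/-! The proof reduces a typewriter code to a binary constant-weight code. Put `w = ⌊a n⌋` and let
`z` run over the `w`-subsets of the coordinates. Each codeword lies in `n.choose w` of the `q ^ n`
sets `{u + word q z}`, so one of these sets receives on average-or-better `M * n.choose w / q ^ n`
codewords, exponentially `2 ^ (n (R - log q + h₂ a))`. Two codewords in the same set differ only
where one has input `u i` and the other `u i + 1`, and these inputs share the single output `u i +
1`. Because the weights are equal, the two likelihoods agree at every common output, so the minimum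
of the likelihoods is their geometric mean, and the overlap is at least the Bhattacharyya product
`α_ε ^ (2 j)`, where `2 j` is the Hamming distance (`Wn_eq_of_ne_zero`, `pow_le_sum_min`). A close
pair therefore forces a large error probability (`exists_pow_le_avgError`).

A close pair exists by the linear programming bound in the Johnson space
(`eventually_card_code_le`): if all Johnson distances are at least `n T + 1`, with `T` above half of
`lp2Fun (a, b)`, the code has size at most `2 ^ (n h₂ b)` up to a polynomial factor. The pigeonhole
count exceeds this as soon as `1 - h₂ a + h₂ b < R - log (q / 2)`, the constraint in `deltaLP2`.

The linear programming bound tests the code against `(d - dist) G ^ 2`, where `G` is a nonnegative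
combination of zonal kernels of index at most `b n`. If `(τ - dist) G` also has nonnegative
coefficients, Schur's product theorem makes `(τ - dist) G * G` positive semidefinite, so no
linearization of products of Hahn polynomials is needed (`card_code_le`). The coefficients of `G`
are a sine profile adapted to the three-term recurrence, which is a tridiagonal matrix with nearly
constant entries on a bounded window of indices (`card_code_le_of_window`). -/

namespace Johnson

/-! ### Hahn polynomials: recurrence in the index and difference equation in the distance. -/

open Finset

/-- Coefficients of the zonal (Hahn) polynomial of the Johnson space in the binomial basis. -/
noncomputable def hahnCoeff (n w : ℕ) (κ : ℝ) (l : ℕ) : ℝ :=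
  ∏ i ∈ range l, ((i - κ) * (n + 1 - κ - i)) / ((w - i) * (n - w - i))

/-- The zonal polynomial of index `κ` of the Johnson space, as a function of the distance,
normalized to be `1` at distance `0`. -/
noncomputable def hahn (n w : ℕ) (κ : ℝ) (j : ℕ) : ℝ :=
  ∑ l ∈ range (w + 1), hahnCoeff n w κ l * (j.choose l : ℝ)

/-- The upper coefficient in the three-term recurrence of `hahn`. -/
noncomputable def up (n w : ℕ) (κ : ℝ) : ℝ :=
  (w - κ) * (n - w - κ) * (n + 1 - κ) / ((n - 2 * κ) * (n + 1 - 2 * κ))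

/-- The lower coefficient in the three-term recurrence of `hahn`. -/
noncomputable def down (n w : ℕ) (κ : ℝ) : ℝ :=
  κ * (n + 1 - w - κ) * (w + 1 - κ) / ((n + 2 - 2 * κ) * (n + 1 - 2 * κ))

section Algebra

variable {n w : ℕ}

theorem denom_ne_zero (h : 2 * w ≤ n) {l : ℕ} (hl : l < w) :
    ((w : ℝ) - l) * (n - w - l) ≠ 0 := by
  have h' : 2 * (w : ℝ) ≤ n := by exact_mod_cast h
  have hl' : (l : ℝ) < w := by exact_mod_cast hl
  have : 0 < ((w : ℝ) - l) * (n - w - l) := mul_pos (by linarith) (by linarith)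
  exact this.ne'

@[simp]
theorem hahnCoeff_zero (κ : ℝ) : hahnCoeff n w κ 0 = 1 := by simp [hahnCoeff]

theorem hahnCoeff_succ (κ : ℝ) (l : ℕ) : hahnCoeff n w κ (l + 1) =
    hahnCoeff n w κ l * (((l - κ) * (n + 1 - κ - l)) / ((w - l) * (n - w - l))) := by
  rw [hahnCoeff, prod_range_succ, hahnCoeff]

theorem hahnCoeff_succ_mul (h : 2 * w ≤ n) (κ : ℝ) {l : ℕ} (hl : l < w) :
    hahnCoeff n w κ (l + 1) * ((w - l) * (n - w - l)) =
      hahnCoeff n w κ l * ((l - κ) * (n + 1 - κ - l)) := by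
  have := denom_ne_zero h hl
  rw [hahnCoeff_succ, mul_assoc, div_mul_cancel₀ _ this]

/-- Raising the index shifts both rising-factorial products by one place, so all but a few factors
cancel. With its companion `hahnCoeff_sub_one` it brings the neighbouring indices in the recurrence
back to the single quantity `hahnCoeff n w κ l`. -/
theorem hahnCoeff_add_one (h : 2 * w ≤ n) (κ : ℝ) {l : ℕ} (hl : l < w) :
    hahnCoeff n w (κ + 1) (l + 1) * (n + 1 - κ) * ((w - l) * (n - w - l)) =
      -((κ + 1) * (n + 1 - κ - l) * (n - κ - l)) * hahnCoeff n w κ l := by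
  have h1 := hahnCoeff_succ_mul h (κ + 1) hl
  induction l with
  | zero =>
    simp only [hahnCoeff_zero, Nat.cast_zero] at h1 ⊢
    linear_combination (n + 1 - κ) * h1
  | succ l ih =>
    have ih := ih (by omega) (hahnCoeff_succ_mul h (κ + 1) (by omega))
    have h2 := hahnCoeff_succ_mul h κ (l := l) (by omega)
    have hd := denom_ne_zero h (l := l) (by omega)
    apply mul_right_cancel₀ hd
    push_cast at h1 ih ⊢
    linear_combination (n + 1 - κ) * ((w - l) * (n - w - l)) * h1 +
      (l - κ) * (n - 1 - κ - l) * ih -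
      (-((κ + 1) * (n - κ - l) * (n - 1 - κ - l))) * h2

theorem hahnCoeff_sub_one (h : 2 * w ≤ n) (κ : ℝ) {l : ℕ} (hl : l < w) :
    hahnCoeff n w (κ - 1) (l + 1) * κ * ((w - l) * (n - w - l)) =
      -((l - κ) * (l + 1 - κ) * (n + 2 - κ)) * hahnCoeff n w κ l := by
  have h1 := hahnCoeff_succ_mul h (κ - 1) hl
  induction l with
  | zero =>
    simp only [hahnCoeff_zero, Nat.cast_zero] at h1 ⊢
    linear_combination κ * h1
  | succ l ih =>
    have ih := ih (by omega) (hahnCoeff_succ_mul h (κ - 1) (by omega))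
    have h2 := hahnCoeff_succ_mul h κ (l := l) (by omega)
    have hd := denom_ne_zero h (l := l) (by omega)
    apply mul_right_cancel₀ hd
    push_cast at h1 ih ⊢
    linear_combination κ * ((w - l) * (n - w - l)) * h1 +
      (l + 2 - κ) * (n + 1 - κ - l) * ih -
      (-((l + 1 - κ) * (l + 2 - κ) * (n + 2 - κ))) * h2

/-- This is the recurrence `neg_mul_hahn` read off at the basis element `j.choose (l + 1)`. After
the index shifts it becomes a rational identity in `n`, `w`, `κ`, `l`. -/
theorem hahnCoeff_three_term (h : 2 * w ≤ n) {κ : ℝ} (hκ : 2 * κ < n) {l : ℕ} (hl : l < w) :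
    -((l + 1) * (hahnCoeff n w κ (l + 1) + hahnCoeff n w κ l)) =
      up n w κ * hahnCoeff n w (κ + 1) (l + 1) -
        (up n w κ + down n w κ) * hahnCoeff n w κ (l + 1) +
        down n w κ * hahnCoeff n w (κ - 1) (l + 1) := by
  have h0 := hahnCoeff_succ_mul h κ hl
  have h1 := hahnCoeff_add_one h κ hl
  have h2 := hahnCoeff_sub_one h κ hl
  have hd := denom_ne_zero h hl
  have e1 : (n : ℝ) - 2 * κ ≠ 0 := by linarith
  have e2 : (n : ℝ) + 1 - 2 * κ ≠ 0 := by linarith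
  have e3 : (n : ℝ) + 2 - 2 * κ ≠ 0 := by linarith
  apply mul_right_cancel₀ hd
  have a0 : up n w κ * hahnCoeff n w (κ + 1) (l + 1) * ((w - l) * (n - w - l)) =
      (w - κ) * (n - w - κ) / ((n - 2 * κ) * (n + 1 - 2 * κ)) *
        (-((κ + 1) * (n + 1 - κ - l) * (n - κ - l)) * hahnCoeff n w κ l) := by
    rw [← h1, up]; ring
  have a1 : down n w κ * hahnCoeff n w (κ - 1) (l + 1) * ((w - l) * (n - w - l)) =
      (n + 1 - w - κ) * (w + 1 - κ) / ((n + 2 - 2 * κ) * (n + 1 - 2 * κ)) *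
        (-((l - κ) * (l + 1 - κ) * (n + 2 - κ)) * hahnCoeff n w κ l) := by
    rw [← h2, down]; ring
  have : -((l + 1) * (hahnCoeff n w κ l * ((l - κ) * (n + 1 - κ - l)) +
        hahnCoeff n w κ l * ((w - l) * (n - w - l)))) =
      (w - κ) * (n - w - κ) / ((n - 2 * κ) * (n + 1 - 2 * κ)) *
        (-((κ + 1) * (n + 1 - κ - l) * (n - κ - l)) * hahnCoeff n w κ l) -
      (up n w κ + down n w κ) * (hahnCoeff n w κ l * ((l - κ) * (n + 1 - κ - l))) +
      (n + 1 - w - κ) * (w + 1 - κ) / ((n + 2 - 2 * κ) * (n + 1 - 2 * κ)) *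
        (-((l - κ) * (l + 1 - κ) * (n + 2 - κ)) * hahnCoeff n w κ l) := by
    rw [up, down]
    obtain ⟨A, hA⟩ : ∃ A : ℝ, A = n - 2 * κ := ⟨_, rfl⟩
    have f1 : (n : ℝ) + 1 - 2 * κ = A + 1 := by rw [hA]; ring
    have f2 : (n : ℝ) + 2 - 2 * κ = A + 2 := by rw [hA]; ring
    rw [f1] at e2 ⊢
    rw [f2] at e3 ⊢
    rw [← hA] at e1 ⊢
    rw [show (n : ℝ) = A + 2 * κ by rw [hA]; ring]
    generalize hahnCoeff n w κ l = X
    field_simp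
    ring
  linear_combination this - a0 - a1 - (l + 1) * h0 + (up n w κ + down n w κ) * h0

theorem hahn_zero_right (κ : ℝ) : hahn n w κ 0 = 1 := by
  rw [hahn, sum_range_succ']
  simp

theorem hahn_zero_left (j : ℕ) : hahn n w 0 j = 1 := by
  rw [hahn, sum_range_succ']
  have : ∀ l, hahnCoeff n w 0 (l + 1) = 0 := fun l => by
    rw [hahnCoeff]
    exact prod_eq_zero (i := 0) (by simp) (by simp)
  simp [this]

theorem cast_mul_choose (j l : ℕ) :
    (j : ℝ) * j.choose l = l * j.choose l + (l + 1) * j.choose (l + 1) := by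
  have := Nat.choose_succ_right_eq j l
  rcases le_or_gt l j with hl | hl
  · have h2 : ((j.choose (l + 1) : ℕ) : ℝ) * (l + 1) = j.choose l * ((j : ℝ) - l) := by
      rw [← Nat.cast_sub hl]; exact_mod_cast this
    linear_combination -h2
  · simp [Nat.choose_eq_zero_of_lt hl, Nat.choose_eq_zero_of_lt (Nat.lt_succ_of_lt hl)]

/-- The three-term recurrence of the zonal polynomials of the Johnson space. -/
theorem neg_mul_hahn (h : 2 * w ≤ n) {κ : ℝ} (hκ : 2 * κ < n) {j : ℕ} (hj : j ≤ w) :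
    -(j : ℝ) * hahn n w κ j = up n w κ * hahn n w (κ + 1) j -
      (up n w κ + down n w κ) * hahn n w κ j + down n w κ * hahn n w (κ - 1) j := by
  have key : (j : ℝ) * hahn n w κ j = ∑ l ∈ range w,
      ((l + 1) * (hahnCoeff n w κ (l + 1) + hahnCoeff n w κ l)) * j.choose (l + 1) := by
    have e : (j : ℝ) * hahn n w κ j =
        ∑ l ∈ range (w + 1), hahnCoeff n w κ l * (l * j.choose l) +
        ∑ l ∈ range (w + 1), hahnCoeff n w κ l * ((l + 1) * j.choose (l + 1)) := by
      rw [hahn, mul_sum, ← sum_add_distrib]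
      refine sum_congr rfl fun l _ => ?_
      linear_combination hahnCoeff n w κ l * cast_mul_choose j l
    -- The last term of the second sum contains `j.choose (w + 1)`, which vanishes because `j ≤ w`.
    rw [e, sum_range_succ', sum_range_succ _ w,
      Nat.choose_eq_zero_of_lt (Nat.lt_succ_of_le hj)]
    simp only [Nat.cast_zero, zero_mul, mul_zero, add_zero]
    rw [← sum_add_distrib]
    refine sum_congr rfl fun l _ => ?_
    push_cast
    ring
  have key2 : -((j : ℝ) * hahn n w κ j) = ∑ l ∈ range w,
      (up n w κ * hahnCoeff n w (κ + 1) (l + 1) -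
        (up n w κ + down n w κ) * hahnCoeff n w κ (l + 1) +
        down n w κ * hahnCoeff n w (κ - 1) (l + 1)) * j.choose (l + 1) := by
    rw [key, ← sum_neg_distrib]
    refine sum_congr rfl fun l hl => ?_
    rw [← hahnCoeff_three_term h hκ (mem_range.1 hl)]
    ring
  rw [neg_mul, key2]
  simp only [hahn]
  rw [sum_range_succ', sum_range_succ', sum_range_succ']
  simp only [hahnCoeff_zero, add_mul, sub_mul, sum_add_distrib, sum_sub_distrib, mul_add, mul_sum,
    mul_assoc]
  ring

/-- For an integer index the series terminates at `l = k`; this removes the boundary term at `l = w`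
in `laplace_hahn`. -/
theorem hahnCoeff_top {k : ℕ} (hk : k ≤ w) : ((w : ℝ) - k) * hahnCoeff n w k w = 0 := by
  rcases hk.eq_or_lt with rfl | hk
  · simp
  · rw [hahnCoeff, prod_eq_zero (i := k) (by simpa using hk) (by simp), mul_zero]

/-- The radial Laplacian is bidiagonal in the binomial basis, so an eigenfunction has coefficients
given by a two-term recursion, namely `hahnCoeff_succ_mul`. -/
theorem laplace_choose (n w j l : ℕ) :
    ((w : ℝ) - j) * (n - w - j) * ((j + 1).choose (l + 1) - j.choose (l + 1)) +
      (j : ℝ) ^ 2 * ((j - 1).choose (l + 1) - j.choose (l + 1)) =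
      -((l + 1) * (n - l)) * j.choose (l + 1) + (w - l) * (n - w - l) * j.choose l := by
  have h1 : (((j + 1).choose (l + 1) : ℕ) : ℝ) = j.choose l + j.choose (l + 1) := by
    rw [Nat.choose_succ_succ]; push_cast; ring
  have h2 : (j : ℝ) * ((j - 1).choose (l + 1) - j.choose (l + 1)) =
      -(l + 1) * j.choose (l + 1) := by
    cases j with
    | zero => simp
    | succ j =>
      have h3 : (((j + 1).choose (l + 1) : ℕ) : ℝ) = j.choose l + j.choose (l + 1) := by
        rw [Nat.choose_succ_succ]; push_cast; ring
      have h4 : ((j + 1 : ℕ) : ℝ) * j.choose l = (j + 1).choose (l + 1) * ((l + 1 : ℕ) : ℝ) := by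
        exact_mod_cast Nat.add_one_mul_choose_eq j l
      simp only [Nat.add_sub_cancel]
      push_cast at h4 ⊢
      linear_combination (-((j : ℝ) + 1)) * h3 - h4
  have h3 := cast_mul_choose j l
  have h4 := cast_mul_choose j (l + 1)
  push_cast at h4
  rw [h1]
  linear_combination j * h2 + (-(n : ℝ) + j + l) * h3

/-- The zonal polynomials are eigenfunctions of the radial part of the Laplacian. -/
theorem laplace_hahn (h : 2 * w ≤ n) {k : ℕ} (hk : k ≤ w) (j : ℕ) :
    ((w : ℝ) - j) * (n - w - j) * (hahn n w k (j + 1) - hahn n w k j) +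
      (j : ℝ) ^ 2 * (hahn n w k (j - 1) - hahn n w k j) =
      -(k * (n + 1 - k)) * hahn n w k j := by
  have e : ((w : ℝ) - j) * (n - w - j) * (hahn n w k (j + 1) - hahn n w k j) +
      (j : ℝ) ^ 2 * (hahn n w k (j - 1) - hahn n w k j) =
      ∑ l ∈ range w, hahnCoeff n w k (l + 1) *
        (-((l + 1) * (n - l)) * j.choose (l + 1) + (w - l) * (n - w - l) * j.choose l) := by
    simp only [← laplace_choose]
    simp only [hahn]
    rw [sum_range_succ', sum_range_succ', sum_range_succ']
    simp only [Nat.choose_zero_right, add_sub_add_right_eq_sub, ← sum_sub_distrib, mul_sum,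
      ← sum_add_distrib]
    refine sum_congr rfl fun l _ => ?_
    ring
  rw [e]
  have e1 : ∑ l ∈ range w, hahnCoeff n w k (l + 1) *
        (-((l + 1) * (n - l)) * j.choose (l + 1) + (w - l) * (n - w - l) * j.choose l) =
      ∑ l ∈ range w, hahnCoeff n w k (l + 1) * (-((l + 1) * (n - l)) * j.choose (l + 1)) +
      ∑ l ∈ range w, hahnCoeff n w k l * ((l - k) * (n + 1 - k - l)) * j.choose l := by
    rw [← sum_add_distrib]
    refine sum_congr rfl fun l hl => ?_
    linear_combination (j.choose l : ℝ) * hahnCoeff_succ_mul h k (mem_range.1 hl)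
  have e2 : ∑ l ∈ range w, hahnCoeff n w k l * ((l - k) * (n + 1 - k - l)) * j.choose l =
      ∑ l ∈ range (w + 1), hahnCoeff n w k l * ((l - k) * (n + 1 - k - l)) * j.choose l := by
    rw [sum_range_succ]
    linear_combination -((n : ℝ) + 1 - k - w) * j.choose w * hahnCoeff_top (n := n) hk
  have e3 : ∑ l ∈ range w, hahnCoeff n w k (l + 1) * (-((l + 1) * (n - l)) * j.choose (l + 1)) =
      ∑ l ∈ range (w + 1), hahnCoeff n w k l * (-(l * (n + 1 - l)) * j.choose l) := by
    rw [sum_range_succ']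
    simp only [Nat.cast_zero, zero_mul, neg_zero, mul_zero, add_zero]
    refine sum_congr rfl fun l _ => ?_
    push_cast
    ring
  rw [e1, e2, e3, ← sum_add_distrib, hahn, mul_sum]
  refine sum_congr rfl fun l _ => ?_
  ring

/-- A solution of the radial eigenvalue equation is determined by its value at distance `0`. -/
theorem radial_unique (h : 2 * w ≤ n) {μ : ℝ} {f g : ℕ → ℝ} (h0 : f 0 = g 0)
    (hf : ∀ j ≤ w, ((w : ℝ) - j) * (n - w - j) * (f (j + 1) - f j) +
      (j : ℝ) ^ 2 * (f (j - 1) - f j) = μ * f j)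
    (hg : ∀ j ≤ w, ((w : ℝ) - j) * (n - w - j) * (g (j + 1) - g j) +
      (j : ℝ) ^ 2 * (g (j - 1) - g j) = μ * g j) :
    ∀ j ≤ w, f j = g j := by
  intro j
  induction j using Nat.strong_induction_on with
  | _ j ih =>
    intro hj
    cases j with
    | zero => exact h0
    | succ j =>
      have i1 := ih j (by omega) (by omega)
      have i2 := ih (j - 1) (by omega) (by omega)
      have f1 := hf j (by omega)
      have g1 := hg j (by omega)
      -- The equation at `j` determines the value at `j + 1`, whose coefficient is nonzero for `j <
      -- w`. At `j = 0` the truncated `j - 1` is harmless, as its term has the factor `j ^ 2`.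
      apply mul_left_cancel₀ (denom_ne_zero h (l := j) (by omega))
      rw [← i1, ← i2] at g1
      linear_combination f1 - g1

end Algebra

end Johnson

/-! ### The Johnson space: distance, transpositions and two-point homogeneity. -/

namespace Johnson

open Finset

/-- The Johnson space: `w`-element subsets of `Fin n`. -/
abbrev Slice (n w : ℕ) := {x : Finset (Fin n) // x.card = w}

namespace Slice

variable {n w : ℕ}

/-- The Johnson distance (half of the Hamming distance). -/
def dist (x y : Slice n w) : ℕ := (x.1 \ y.1).card

/-- The action of permutations on the Johnson space. -/
def act (σ : Equiv.Perm (Fin n)) (x : Slice n w) : Slice n w :=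
  ⟨x.1.map σ.toEmbedding, by rw [card_map, x.2]⟩

theorem dist_add_inter (x y : Slice n w) : dist x y + (x.1 ∩ y.1).card = w := by
  rw [dist, card_sdiff_add_card_inter, x.2]

theorem dist_le (x y : Slice n w) : dist x y ≤ w := by
  have := dist_add_inter x y; omega

theorem dist_comm (x y : Slice n w) : dist x y = dist y x := by
  have h1 := dist_add_inter x y
  have h2 := dist_add_inter y x
  rw [inter_comm] at h2
  omega

@[simp]
theorem dist_self (x : Slice n w) : dist x x = 0 := by simp [dist]

@[simp]
theorem dist_act (σ : Equiv.Perm (Fin n)) (x y : Slice n w) :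
    dist (act σ x) (act σ y) = dist x y := by
  simp only [dist, act]
  rw [← Finset.map_sdiff, card_map]

theorem act_injective (σ : Equiv.Perm (Fin n)) : Function.Injective (act (w := w) σ) := by
  intro x y h
  apply Subtype.ext
  exact map_injective σ.toEmbedding (congrArg Subtype.val h)

theorem sum_act (σ : Equiv.Perm (Fin n)) (u : Slice n w → ℝ) :
    ∑ y, u (act σ y) = ∑ y, u y :=
  (Finite.injective_iff_bijective.1 (act_injective σ)).sum_comp u

theorem act_swap_act_swap (a b : Fin n) (x : Slice n w) :
    act (Equiv.swap a b) (act (Equiv.swap a b) x) = x := by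
  apply Subtype.ext
  ext c
  simp [act]

/-- The real-valued indicator function of a set. -/
def ind (s : Finset (Fin n)) (a : Fin n) : ℝ := if a ∈ s then 1 else 0

theorem sum_ind (s : Finset (Fin n)) : ∑ a, ind s a = s.card := by simp [ind]

theorem ind_mul_ind (s t : Finset (Fin n)) (a : Fin n) : ind s a * ind t a = ind (s ∩ t) a := by
  by_cases h1 : a ∈ s <;> by_cases h2 : a ∈ t <;> simp [ind, h1, h2]

theorem sum_ind_mul_ind (x y : Slice n w) : ∑ a, ind x.1 a * ind y.1 a = w - dist x y := by
  have := dist_add_inter x y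
  simp only [ind_mul_ind, sum_ind]
  have h : ((dist x y : ℕ) : ℝ) + (x.1 ∩ y.1).card = w := by exact_mod_cast this
  linarith

theorem ind_act_swap (a b c : Fin n) (x : Slice n w) :
    ind (act (Equiv.swap a b) x).1 c = ind x.1 c -
      (ind x.1 a - ind x.1 b) * ((if c = a then 1 else 0) - (if c = b then 1 else 0)) := by
  have : ind (act (Equiv.swap a b) x).1 c = ind x.1 (Equiv.swap a b c) := by
    simp [ind, act, Finset.mem_map_equiv]
  rw [this, Equiv.swap_apply_def]
  split_ifs <;> subst_vars <;> simp

theorem dist_act_swap (a b : Fin n) (x y : Slice n w) :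
    (dist (act (Equiv.swap a b) x) y : ℝ) = dist x y +
      (ind x.1 a - ind x.1 b) * (ind y.1 a - ind y.1 b) := by
  have h1 := sum_ind_mul_ind (act (Equiv.swap a b) x) y
  have h2 := sum_ind_mul_ind x y
  simp only [ind_act_swap, sub_mul, mul_sub, sum_sub_distrib, ite_mul, zero_mul,
    mul_ite, mul_one, mul_zero, sum_ite_eq', mem_univ, if_true] at h1
  simp only [h2] at h1
  linarith

/-- A transposition changes the distance by at most one. The products of indicators select the
membership patterns of `a` and `b` in which it rises or falls, in a form that factors when summed
over `a` and `b`. -/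
theorem apply_dist_act_swap (F : ℕ → ℝ) (a b : Fin n) (x y : Slice n w) :
    F (dist (act (Equiv.swap a b) x) y) - F (dist x y) =
      ((ind x.1 a * ind y.1 a) * ((1 - ind x.1 b) * (1 - ind y.1 b)) +
        ((1 - ind x.1 a) * (1 - ind y.1 a)) * (ind x.1 b * ind y.1 b)) *
          (F (dist x y + 1) - F (dist x y)) +
      ((ind x.1 a * (1 - ind y.1 a)) * ((1 - ind x.1 b) * ind y.1 b) +
        ((1 - ind x.1 a) * ind y.1 a) * (ind x.1 b * (1 - ind y.1 b))) *
          (F (dist x y - 1) - F (dist x y)) := by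
  have h := dist_act_swap a b x y
  set d' := dist (act (Equiv.swap a b) x) y
  set d := dist x y
  by_cases h1 : a ∈ x.1 <;> by_cases h2 : b ∈ x.1 <;> by_cases h3 : a ∈ y.1 <;>
    by_cases h4 : b ∈ y.1 <;> simp only [ind, h1, h2, h3, h4, if_true, if_false] at h ⊢ <;>
    norm_num at h ⊢
  all_goals first
    | rw [h]; ring
    | (have h' : d' = d + 1 := by exact_mod_cast h
       rw [h'])
    | (have h' : d' + 1 = d := by
        have : (d' : ℝ) + 1 = d := by rw [h]; ring
        exact_mod_cast this
       rw [← h']; simp)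

/-- The Laplacian of the transposition walk, applied to a zonal function. -/
theorem sum_apply_dist_act_swap (F : ℕ → ℝ) (x y : Slice n w) :
    ∑ a, ∑ b, (F (dist (act (Equiv.swap a b) x) y) - F (dist x y)) =
      2 * (((w : ℝ) - dist x y) * (n - w - dist x y) * (F (dist x y + 1) - F (dist x y)) +
        (dist x y : ℝ) ^ 2 * (F (dist x y - 1) - F (dist x y))) := by
  have hxy := sum_ind_mul_ind x y
  have hx : ∑ a, ind x.1 a = w := by rw [sum_ind, x.2]
  have hy : ∑ a, ind y.1 a = w := by rw [sum_ind, y.2]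
  have e1 : ∑ a, (1 - ind x.1 a) * (1 - ind y.1 a) = (n : ℝ) - w - dist x y := by
    simp only [sub_mul, mul_sub, one_mul, mul_one, sum_sub_distrib, hxy, hx, hy, sum_const,
      card_univ, Fintype.card_fin, nsmul_eq_mul]
    ring
  have e2 : ∑ a, ind x.1 a * (1 - ind y.1 a) = (dist x y : ℝ) := by
    simp only [mul_sub, mul_one, sum_sub_distrib, hxy, hx]; ring
  have e3 : ∑ a, (1 - ind x.1 a) * ind y.1 a = (dist x y : ℝ) := by
    simp only [sub_mul, one_mul, sum_sub_distrib, hxy, hy]; ring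
  simp only [apply_dist_act_swap, sum_add_distrib, ← sum_mul, ← mul_sum, hxy, e1, e2, e3]
  ring

/-- The Johnson space is two-point homogeneous. -/
theorem exists_act_eq {x y x' y' : Slice n w} (h : dist x y = dist x' y') :
    ∃ σ, act σ x = x' ∧ act σ y = y' := by
  -- Membership in the two sets cuts `Fin n` into four cells whose sizes depend only on `n`, `w` and
  -- the distance. Bijections between corresponding cells glue to a permutation.
  have key : ∀ c : Bool × Bool,
      Nonempty ({a // (decide (a ∈ x.1), decide (a ∈ y.1)) = c} ≃
        {a // (decide (a ∈ x'.1), decide (a ∈ y'.1)) = c}) := by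
    intro c
    refine ⟨Fintype.equivOfCardEq ?_⟩
    rw [Fintype.card_subtype, Fintype.card_subtype]
    have a1 := dist_add_inter x y
    have a2 := dist_add_inter x' y'
    have b1 := dist_add_inter y x
    have b2 := dist_add_inter y' x'
    rw [inter_comm] at b1 b2
    have c1 := card_union_add_card_inter x.1 y.1
    have c2 := card_union_add_card_inter x'.1 y'.1
    have d1 := card_compl_add_card (x.1 ∪ y.1)
    have d2 := card_compl_add_card (x'.1 ∪ y'.1)
    rw [x.2, y.2] at c1
    rw [x'.2, y'.2] at c2
    simp only [dist] at h a1 a2 b1 b2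
    have f : ∀ (s : Finset (Fin n)) (p : Fin n → Prop) [DecidablePred p],
        (∀ a, p a ↔ a ∈ s) → (univ.filter p).card = s.card := by
      intro s p _ hp
      congr 1
      ext a
      simp [hp]
    obtain ⟨_ | _, _ | _⟩ := c
    · rw [f (x.1 ∪ y.1)ᶜ _ (by simp), f (x'.1 ∪ y'.1)ᶜ _ (by simp)]
      omega
    · rw [f (y.1 \ x.1) _ (by simp [and_comm]), f (y'.1 \ x'.1) _ (by simp [and_comm])]
      omega
    · rw [f (x.1 \ y.1) _ (by simp), f (x'.1 \ y'.1) _ (by simp)]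
      omega
    · rw [f (x.1 ∩ y.1) _ (by simp), f (x'.1 ∩ y'.1) _ (by simp)]
      omega
  let σ : Equiv.Perm (Fin n) := Equiv.ofFiberEquiv fun c => (key c).some
  have hσ : ∀ a, (decide (σ a ∈ x'.1), decide (σ a ∈ y'.1)) = (decide (a ∈ x.1), decide (a ∈ y.1)) :=
    fun a => Equiv.ofFiberEquiv_map (fun c => (key c).some) a
  simp only [Prod.mk.injEq, decide_eq_decide] at hσ
  refine ⟨σ, Subtype.ext ?_, Subtype.ext ?_⟩
  · ext a
    simp only [act, mem_map_equiv, ← (hσ _).1, Equiv.apply_symm_apply]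
  · ext a
    simp only [act, mem_map_equiv, ← (hσ _).2, Equiv.apply_symm_apply]

theorem exists_dist_eq (h : 2 * w ≤ n) {j : ℕ} (hj : j ≤ w) :
    ∃ x y : Slice n w, dist x y = j := by
  obtain ⟨x, -, hx⟩ := exists_subset_card_eq (s := (univ : Finset (Fin n))) (n := w)
    (by simp; omega)
  obtain ⟨s, hs, hsc⟩ := exists_subset_card_eq (s := x) (n := w - j) (by omega)
  obtain ⟨t, ht, htc⟩ := exists_subset_card_eq (s := xᶜ) (n := j)
    (by rw [card_compl, Fintype.card_fin]; omega)
  have hd : Disjoint s t :=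
    disjoint_of_subset_left hs (disjoint_of_subset_right ht disjoint_compl_right)
  refine ⟨⟨x, hx⟩, ⟨s ∪ t, by rw [card_union_of_disjoint hd]; omega⟩, ?_⟩
  have : x \ (s ∪ t) = x \ s := by
    ext a
    have : a ∈ t → a ∉ x := fun h => by simpa using ht h
    simp only [mem_sdiff, mem_union]
    tauto
  simp only [dist, this]
  rw [card_sdiff_of_subset hs]
  omega

theorem sum_apply_dist_eq (F : ℕ → ℝ) (x x' : Slice n w) :
    ∑ y, F (dist x y) = ∑ y, F (dist x' y) := by
  obtain ⟨σ, hσ, -⟩ := exists_act_eq (x := x) (y := x) (x' := x') (y' := x') (by simp)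
  rw [← sum_act σ (fun y => F (dist x' y)), ← hσ]
  simp

end Slice

/-! ### Zonal kernels: orthogonality, idempotence and positive semidefiniteness. -/

open Slice

variable {n w : ℕ}

/-- The zonal kernels on the Johnson space. -/
noncomputable def zonal (n w k : ℕ) (x y : Slice n w) : ℝ := hahn n w k (dist x y)

theorem zonal_comm (k : ℕ) (x y : Slice n w) : zonal n w k x y = zonal n w k y x := by
  rw [zonal, dist_comm, zonal]

@[simp]
theorem zonal_self (k : ℕ) (x : Slice n w) : zonal n w k x x = 1 := by
  rw [zonal, dist_self, hahn_zero_right]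

theorem sum_zonal_act_swap (h : 2 * w ≤ n) {k : ℕ} (hk : k ≤ w) (x y : Slice n w) :
    ∑ a, ∑ b, (zonal n w k (act (Equiv.swap a b) x) y - zonal n w k x y) =
      -(2 * (k * (n + 1 - k))) * zonal n w k x y := by
  simp only [zonal]
  rw [sum_apply_dist_act_swap, laplace_hahn h hk]
  ring

theorem laplace_self_adjoint (u v : Slice n w → ℝ) :
    ∑ y, (∑ a, ∑ b, (u (act (Equiv.swap a b) y) - u y)) * v y =
      ∑ y, u y * ∑ a, ∑ b, (v (act (Equiv.swap a b) y) - v y) := by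
  simp only [sum_mul, mul_sum]
  rw [sum_comm, sum_comm (f := fun y a => ∑ b, u y * (v (act (Equiv.swap a b) y) - v y))]
  refine sum_congr rfl fun a _ => ?_
  rw [sum_comm, sum_comm (f := fun y b => u y * (v (act (Equiv.swap a b) y) - v y))]
  refine sum_congr rfl fun b _ => ?_
  simp only [sub_mul, mul_sub, sum_sub_distrib]
  congr 1
  rw [← sum_act (Equiv.swap a b)]
  simp only [act_swap_act_swap]

/-- Zonal kernels of different index are orthogonal. -/
theorem sum_zonal_mul_zonal (h : 2 * w ≤ n) {k l : ℕ} (hk : k ≤ w) (hl : l ≤ w) (hkl : k ≠ l)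
    (x z : Slice n w) : ∑ y, zonal n w k x y * zonal n w l y z = 0 := by
  have key := laplace_self_adjoint (fun y => zonal n w k y x) (fun y => zonal n w l y z)
  simp only [sum_zonal_act_swap h hk, sum_zonal_act_swap h hl] at key
  have e : ∑ y, zonal n w k x y * zonal n w l y z = ∑ y, zonal n w k y x * zonal n w l y z :=
    sum_congr rfl fun y _ => by rw [zonal_comm]
  rw [e]
  -- Self-adjointness makes the difference of eigenvalues annihilate the inner product. That
  -- difference factors, and neither factor vanishes because `k ≠ l` and `k + l ≤ 2 * w ≤ n`.
  have key2 : ((k : ℝ) - l) * (n + 1 - k - l) * ∑ y, zonal n w k y x * zonal n w l y z = 0 := by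
    have k1 : ∑ y, -(2 * (k * (n + 1 - k))) * zonal n w k y x * zonal n w l y z =
        -(2 * (k * (n + 1 - k))) * ∑ y, zonal n w k y x * zonal n w l y z := by
      simp only [mul_sum, mul_assoc]
    have k2 : ∑ y, zonal n w k y x * (-(2 * (l * (n + 1 - l))) * zonal n w l y z) =
        -(2 * (l * (n + 1 - l))) * ∑ y, zonal n w k y x * zonal n w l y z := by
      rw [mul_sum]; exact sum_congr rfl fun y _ => by ring
    rw [k1, k2] at key
    linear_combination (-1 / 2) * key
  have n1 : ((k : ℝ) - l) ≠ 0 := sub_ne_zero.2 (by exact_mod_cast hkl)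
  have n2 : ((n : ℝ) + 1 - k - l) ≠ 0 := by
    have : (k : ℝ) + l ≤ n := by exact_mod_cast (by omega : k + l ≤ n)
    linarith
  simpa [n1, n2] using key2

/-- The squared norm of a row of the zonal kernel. -/
noncomputable def rowNorm (n w k : ℕ) (x : Slice n w) : ℝ := ∑ y, zonal n w k x y ^ 2

theorem rowNorm_pos (k : ℕ) (x : Slice n w) : 0 < rowNorm n w k x := by
  have : zonal n w k x x ^ 2 ≤ rowNorm n w k x :=
    single_le_sum (f := fun y => zonal n w k x y ^ 2) (fun y _ => sq_nonneg _) (mem_univ x)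
  rw [zonal_self] at this
  linarith

theorem rowNorm_eq (k : ℕ) (x x' : Slice n w) : rowNorm n w k x = rowNorm n w k x' :=
  sum_apply_dist_eq (fun j => hahn n w k j ^ 2) x x'

/-- The zonal kernels are idempotent up to a factor. -/
theorem sum_zonal_mul_self (h : 2 * w ≤ n) {k : ℕ} (hk : k ≤ w) (x z : Slice n w) :
    ∑ y, zonal n w k x y * zonal n w k y z = rowNorm n w k x * zonal n w k x z := by
  classical
  -- By homogeneity the composed kernel is a function `g` of the distance. In its first variable it
  -- is a Laplace eigenfunction with the eigenvalue of `zonal n w k`, so `radial_unique` makes it a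
  -- multiple of `hahn`, with the factor read off at distance zero.
  have inv : ∀ x z x' z' : Slice n w, dist x z = dist x' z' →
      ∑ y, zonal n w k x y * zonal n w k y z = ∑ y, zonal n w k x' y * zonal n w k y z' := by
    intro x z x' z' hd
    obtain ⟨σ, rfl, rfl⟩ := exists_act_eq hd
    rw [← sum_act σ (fun y => zonal n w k (act σ x) y * zonal n w k y (act σ z))]
    simp only [zonal, dist_act]
  have hex : ∀ j : ℕ, ∃ c : ℝ, ∀ x z : Slice n w, dist x z = j →
      ∑ y, zonal n w k x y * zonal n w k y z = c := by
    intro j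
    by_cases hj : ∃ x z : Slice n w, dist x z = j
    · obtain ⟨x, z, rfl⟩ := hj
      exact ⟨_, fun x' z' hd => inv _ _ _ _ hd⟩
    · exact ⟨0, fun x z hd => absurd ⟨x, z, hd⟩ hj⟩
  choose g hg using hex
  have hg' : ∀ x z : Slice n w, ∑ y, zonal n w k x y * zonal n w k y z = g (dist x z) :=
    fun x z => hg _ x z rfl
  have g0 : g 0 = rowNorm n w k x := by
    rw [← dist_self x, ← hg', rowNorm]
    exact sum_congr rfl fun y _ => by rw [zonal_comm k y x, sq]
  have hgr : ∀ j ≤ w, ((w : ℝ) - j) * (n - w - j) * (g (j + 1) - g j) +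
      (j : ℝ) ^ 2 * (g (j - 1) - g j) = -(k * (n + 1 - k)) * g j := by
    intro j hj
    obtain ⟨u, v, rfl⟩ := exists_dist_eq h hj
    have e := sum_apply_dist_act_swap g u v
    simp only [← hg', ← sum_sub_distrib, ← sub_mul] at e
    have e2 : ∑ a, ∑ b, ∑ y, (zonal n w k (act (Equiv.swap a b) u) y - zonal n w k u y) *
        zonal n w k y v = ∑ y, (∑ a, ∑ b, (zonal n w k (act (Equiv.swap a b) u) y -
          zonal n w k u y)) * zonal n w k y v := by
      simp only [sum_mul]
      rw [sum_comm (s := (univ : Finset (Slice n w)))]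
      refine sum_congr rfl fun a _ => ?_
      rw [sum_comm]
    rw [e2] at e
    simp only [sum_zonal_act_swap h hk, mul_assoc, ← mul_sum] at e
    simp only [hg'] at e
    linarith
  have := radial_unique h (f := g) (g := fun j => rowNorm n w k x * hahn n w k j)
    (μ := -(k * (n + 1 - k))) (by rw [g0, hahn_zero_right, mul_one]) hgr
    (fun j _ => by linear_combination rowNorm n w k x * laplace_hahn h hk j) _ (dist_le x z)
  rw [hg', this, zonal]

/-- Kernels of the form `K x y = ∑ i, φ i x * φ i y`. -/
def IsGram {X : Type} (K : X → X → ℝ) : Prop :=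
  ∃ (ι : Type) (_ : Fintype ι) (φ : ι → X → ℝ), ∀ x y, K x y = ∑ i, φ i x * φ i y

namespace IsGram

variable {X : Type} {K K' : X → X → ℝ}

theorem mul (hK : IsGram K) (hK' : IsGram K') : IsGram fun x y => K x y * K' x y := by
  obtain ⟨ι, _, φ, h⟩ := hK
  obtain ⟨ι', _, φ', h'⟩ := hK'
  refine ⟨ι × ι', inferInstance, fun i x => φ i.1 x * φ' i.2 x, fun x y => ?_⟩
  simp only [h, h']
  rw [sum_mul_sum, Fintype.sum_prod_type]
  exact sum_congr rfl fun i _ => sum_congr rfl fun j _ => by ring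

theorem add (hK : IsGram K) (hK' : IsGram K') : IsGram fun x y => K x y + K' x y := by
  obtain ⟨ι, _, φ, h⟩ := hK
  obtain ⟨ι', _, φ', h'⟩ := hK'
  refine ⟨ι ⊕ ι', inferInstance, Sum.elim φ φ', fun x y => ?_⟩
  simp [h, h']

theorem const_mul (hK : IsGram K) {c : ℝ} (hc : 0 ≤ c) : IsGram fun x y => c * K x y := by
  obtain ⟨ι, _, φ, h⟩ := hK
  refine ⟨ι, inferInstance, fun i x => √c * φ i x, fun x y => ?_⟩
  simp only [h, mul_sum]
  refine sum_congr rfl fun i _ => ?_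
  linear_combination (-(φ i x * φ i y)) * Real.mul_self_sqrt hc

theorem zero : IsGram fun _ _ : X => (0 : ℝ) :=
  ⟨Empty, inferInstance, fun e => e.elim, by simp⟩

theorem sum {κ : Type} (s : Finset κ) (F : κ → X → X → ℝ) (hF : ∀ i ∈ s, IsGram (F i)) :
    IsGram fun x y => ∑ i ∈ s, F i x y := by
  classical
  induction s using Finset.induction_on with
  | empty => simpa using zero
  | insert a s ha ih =>
    simp only [sum_insert ha]
    exact (hF a (by simp)).add (ih fun i hi => hF i (by simp [hi]))

theorem sum_mul_nonneg [Fintype X] (hK : IsGram K) (v : X → ℝ) :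
    0 ≤ ∑ x, ∑ y, v x * v y * K x y := by
  obtain ⟨ι, _, φ, h⟩ := hK
  have : ∑ x, ∑ y, v x * v y * K x y = ∑ i, (∑ x, v x * φ i x) ^ 2 := by
    simp only [h, sq, sum_mul_sum]
    rw [sum_comm (s := (univ : Finset ι))]
    refine sum_congr rfl fun x _ => ?_
    rw [sum_comm]
    refine sum_congr rfl fun y _ => ?_
    rw [mul_sum]
    exact sum_congr rfl fun i _ => by ring
  rw [this]
  exact sum_nonneg fun i _ => sq_nonneg _

theorem sum_nonneg_of_finset [Fintype X] (hK : IsGram K) (C : Finset X) :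
    0 ≤ ∑ x ∈ C, ∑ y ∈ C, K x y := by
  classical
  have := hK.sum_mul_nonneg fun x => if x ∈ C then 1 else 0
  simpa [ite_mul, mul_ite, sum_ite_mem] using this

/-- The all-ones component of a positive semidefinite kernel with constant row sums. -/
theorem le_sum_of_rowSum [Fintype X] (hK : IsGram K) (hs : ∀ x y, K x y = K y x) {r : ℝ}
    (hr : ∀ x, ∑ y, K x y = r) (C : Finset X) :
    (C.card : ℝ) ^ 2 * r ≤ (Fintype.card X : ℝ) * ∑ x ∈ C, ∑ y ∈ C, K x y := by
  classical
  set N : ℝ := (Fintype.card X : ℝ)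
  -- The test vector is `N` times the indicator of `C` with its mean removed; since row sums are
  -- constant, the cross terms reduce to the constant component.
  have h := hK.sum_mul_nonneg fun x => N * (if x ∈ C then 1 else 0) - C.card
  have e : ∑ x, ∑ y, (N * (if x ∈ C then 1 else 0) - C.card) *
      (N * (if y ∈ C then 1 else 0) - C.card) * K x y =
      N * (N * ∑ x ∈ C, ∑ y ∈ C, K x y - (C.card : ℝ) ^ 2 * r) := by
    have e0 : ∀ x, ∑ y, (N * (if x ∈ C then 1 else 0) - C.card) *
        (N * (if y ∈ C then 1 else 0) - C.card) * K x y =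
        (N * (if x ∈ C then 1 else 0) - C.card) * (N * ∑ y ∈ C, K x y - C.card * r) := by
      intro x
      simp only [mul_assoc, ← mul_sum]
      congr 1
      simp only [sub_mul, sum_sub_distrib, mul_assoc, ← mul_sum, hr, ite_mul, one_mul, zero_mul,
        sum_ite_mem, univ_inter]
    simp only [e0]
    have e1 : ∑ x, ∑ y ∈ C, K x y = C.card * r := by
      have hc : ∀ y, ∑ x, K x y = r := fun y => by
        rw [← hr y]
        exact sum_congr rfl fun x _ => hs x y
      rw [sum_comm]
      simp [hc]
    simp only [sub_mul, sum_sub_distrib, mul_assoc, ← mul_sum, ite_mul, one_mul, zero_mul,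
      sum_ite_mem, univ_inter, mul_sub, e1, sum_const, card_univ, nsmul_eq_mul]
    ring
  rw [e] at h
  rcases isEmpty_or_nonempty X with hX | hX
  · have : C = ∅ := eq_empty_of_isEmpty C
    simp [this]
  · have hN : 0 < N := by simp [N, Fintype.card_pos]
    have := nonneg_of_mul_nonneg_right h hN
    linarith

end IsGram

/-- A symmetric kernel that is idempotent up to a positive factor is a positive multiple of the Gram
kernel of its own rows. -/
theorem isGram_zonal (h : 2 * w ≤ n) {k : ℕ} (hk : k ≤ w) : IsGram (zonal n w k) := by
  rcases isEmpty_or_nonempty (Slice n w) with hX | ⟨⟨o⟩⟩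
  · exact ⟨Empty, inferInstance, fun e => e.elim, fun x => hX.elim x⟩
  · have hp := rowNorm_pos k o
    have : IsGram fun x y => ∑ z, zonal n w k x z * zonal n w k y z :=
      ⟨Slice n w, inferInstance, fun z x => zonal n w k x z, fun x y => rfl⟩
    have h2 := this.const_mul (inv_nonneg.2 hp.le)
    convert h2 using 3 with x y
    have := sum_zonal_mul_self h hk x y
    rw [rowNorm_eq k x o] at this
    simp only [zonal_comm k y]
    rw [this]
    field_simp

end Johnson

/-! ### The linear programming bound for constant-weight codes. -/

namespace Johnson

open Finset Slice

variable {n w : ℕ}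

theorem up_pos (h : 2 * w ≤ n) {k : ℕ} (hk : k < w) : 0 < up n w k := by
  have h1 : (k : ℝ) + 1 ≤ w := by exact_mod_cast hk
  have h2 : 2 * (w : ℝ) ≤ n := by exact_mod_cast h
  have h3 : (0 : ℝ) ≤ k := by positivity
  rw [up]
  apply div_pos
  · exact mul_pos (mul_pos (by linarith) (by linarith)) (by linarith)
  · exact mul_pos (by linarith) (by linarith)

theorem down_nonneg (h : 2 * w ≤ n) {k : ℕ} (hk : k ≤ w) : 0 ≤ down n w k := by
  have h1 : (k : ℝ) ≤ w := by exact_mod_cast hk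
  have h2 : 2 * (w : ℝ) ≤ n := by exact_mod_cast h
  have h3 : (0 : ℝ) ≤ k := by positivity
  rw [down]
  apply div_nonneg
  · exact mul_nonneg (mul_nonneg (by linarith) (by linarith)) (by linarith)
  · exact mul_nonneg (by linarith) (by linarith)

theorem neg_dist_mul_zonal (h : 2 * w ≤ n) {k : ℕ} (hk : 2 * (k + 1) < n) (x y : Slice n w) :
    -(dist x y : ℝ) * zonal n w (k + 1) x y = up n w (k + 1 : ℕ) * zonal n w (k + 2) x y -
      (up n w (k + 1 : ℕ) + down n w (k + 1 : ℕ)) * zonal n w (k + 1) x y +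
      down n w (k + 1 : ℕ) * zonal n w k x y := by
  have := neg_mul_hahn (n := n) (w := w) h (κ := ((k + 1 : ℕ) : ℝ)) (by exact_mod_cast hk)
    (dist_le x y)
  simp only [zonal]
  rw [this]
  push_cast
  rw [show (k : ℝ) + 1 + 1 = k + 2 by ring, show (k : ℝ) + 1 - 1 = k by ring]

theorem neg_dist_mul_zonal_zero (h : 2 * w ≤ n) (hn : 0 < n) (x y : Slice n w) :
    -(dist x y : ℝ) * zonal n w 0 x y = up n w (0 : ℕ) * zonal n w 1 x y -
      (up n w (0 : ℕ) + down n w (0 : ℕ)) * zonal n w 0 x y := by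
  have := neg_mul_hahn (n := n) (w := w) h (κ := ((0 : ℕ) : ℝ)) (by simpa using hn)
    (dist_le x y)
  simp only [zonal]
  rw [this]
  have hd : down n w ((0 : ℕ) : ℝ) = 0 := by simp [down]
  rw [hd]
  push_cast
  ring_nf

theorem sum_zonal_mul_zonal_row (h : 2 * w ≤ n) {k l : ℕ} (hk : k ≤ w) (hl : l ≤ w) (hkl : k ≠ l)
    (x : Slice n w) : ∑ y, zonal n w k x y * zonal n w l x y = 0 := by
  rw [← sum_zonal_mul_zonal h hk hl hkl x x]
  exact sum_congr rfl fun y _ => by rw [zonal_comm l]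

/-- Multiplication by the distance is symmetric: pairing `dist` times one kernel with its neighbour
can be expanded by the recurrence on either side, and orthogonality leaves one term each time. -/
theorem down_mul_rowNorm (h : 2 * w ≤ n) {k : ℕ} (hk : k + 2 ≤ w) (x : Slice n w) :
    down n w (k + 1 : ℕ) * rowNorm n w k x = up n w k * rowNorm n w (k + 1) x := by
  have o1 := sum_zonal_mul_zonal_row h (k := k) (l := k + 2) (by omega) (by omega) (by omega) x
  have o2 := sum_zonal_mul_zonal_row h (k := k) (l := k + 1) (by omega) (by omega) (by omega) x
  have e1 : ∑ y, (-(dist x y : ℝ) * zonal n w (k + 1) x y) * zonal n w k x y =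
      down n w (k + 1 : ℕ) * rowNorm n w k x := by
    have : ∀ y, (-(dist x y : ℝ) * zonal n w (k + 1) x y) * zonal n w k x y =
        up n w (k + 1 : ℕ) * (zonal n w k x y * zonal n w (k + 2) x y) -
        (up n w (k + 1 : ℕ) + down n w (k + 1 : ℕ)) * (zonal n w k x y * zonal n w (k + 1) x y) +
        down n w (k + 1 : ℕ) * zonal n w k x y ^ 2 := fun y => by
      rw [neg_dist_mul_zonal h (by omega)]; ring
    simp only [this, sum_add_distrib, sum_sub_distrib, ← mul_sum, o1, o2, rowNorm]
    ring
  have e2 : ∑ y, (-(dist x y : ℝ) * zonal n w k x y) * zonal n w (k + 1) x y =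
      up n w k * rowNorm n w (k + 1) x := by
    cases k with
    | zero =>
      have : ∀ y, (-(dist x y : ℝ) * zonal n w 0 x y) * zonal n w (0 + 1) x y =
          up n w (0 : ℕ) * zonal n w (0 + 1) x y ^ 2 -
          (up n w (0 : ℕ) + down n w (0 : ℕ)) * (zonal n w 0 x y * zonal n w (0 + 1) x y) :=
        fun y => by rw [neg_dist_mul_zonal_zero h (by omega)]; ring
      simp only [this, sum_sub_distrib, ← mul_sum, o2, rowNorm]
      ring
    | succ k =>
      have o3 := sum_zonal_mul_zonal_row h (k := k) (l := k + 2) (by omega) (by omega)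
        (by omega) x
      have : ∀ y, (-(dist x y : ℝ) * zonal n w (k + 1) x y) * zonal n w (k + 1 + 1) x y =
          up n w (k + 1 : ℕ) * zonal n w (k + 1 + 1) x y ^ 2 -
          (up n w (k + 1 : ℕ) + down n w (k + 1 : ℕ)) *
            (zonal n w (k + 1) x y * zonal n w (k + 1 + 1) x y) +
          down n w (k + 1 : ℕ) * (zonal n w k x y * zonal n w (k + 2) x y) := fun y => by
        rw [neg_dist_mul_zonal h (by omega)]; ring
      simp only [this, sum_add_distrib, sum_sub_distrib, ← mul_sum, o2, o3, rowNorm]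
      ring
  rw [← e1, ← e2]
  exact sum_congr rfl fun y _ => by ring

/-- The multiplicity of index `k` is the size of the space divided by `rowNorm`, so by
`down_mul_rowNorm` consecutive multiplicities have ratio `up` over `down`. Here this ratio is
bounded by that of consecutive binomial coefficients, the inductive step of
`card_le_choose_mul_rowNorm`. -/
theorem choose_mul_up_le (h : 2 * w ≤ n) {k : ℕ} (hk : k + 2 ≤ w) :
    (n.choose k : ℝ) * up n w k ≤ n.choose (k + 1) * down n w (k + 1 : ℕ) := by
  have h1 : (k : ℝ) + 2 ≤ w := by exact_mod_cast hk
  have h2 : 2 * (w : ℝ) ≤ n := by exact_mod_cast h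
  have h3 : (0 : ℝ) ≤ k := by positivity
  have e : ((n.choose (k + 1) : ℕ) : ℝ) * (k + 1) = n.choose k * ((n : ℝ) - k) := by
    rw [← Nat.cast_sub (by omega)]; exact_mod_cast Nat.choose_succ_right_eq n k
  have e1 : (n.choose (k + 1) : ℝ) * down n w (k + 1 : ℕ) =
      (n.choose k * (((w : ℝ) - k) * (n - w - k))) *
        ((n - k) / ((n - 2 * k) * (n - 1 - 2 * k))) := by
    rw [down]
    push_cast
    rw [show (n : ℝ) + 2 - 2 * (k + 1) = n - 2 * k by ring,
      show (n : ℝ) + 1 - 2 * (k + 1) = n - 1 - 2 * k by ring, mul_div_assoc', mul_div_assoc']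
    congr 1
    linear_combination (((n : ℝ) - w - k) * (w - k)) * e
  have e2 : (n.choose k : ℝ) * up n w k =
      (n.choose k * (((w : ℝ) - k) * (n - w - k))) *
        ((n + 1 - k) / ((n - 2 * k) * (n + 1 - 2 * k))) := by
    rw [up]; ring
  rw [e1, e2]
  apply mul_le_mul_of_nonneg_left
  · rw [div_le_div_iff₀ (mul_pos (by linarith) (by linarith)) (mul_pos (by linarith) (by linarith))]
    have : ((n : ℝ) + 1 - k) * (n - 1 - 2 * k) ≤ (n - k) * (n + 1 - 2 * k) := by nlinarith
    have h5 : (0 : ℝ) ≤ n - 2 * k := by linarith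
    nlinarith [mul_le_mul_of_nonneg_left this h5]
  · exact mul_nonneg (by positivity) (mul_nonneg (by linarith) (by linarith))

/-- The multiplicity of the `k`-th eigenspace is at most `n.choose k`. -/
theorem card_le_choose_mul_rowNorm (h : 2 * w ≤ n) {k : ℕ} (hk : k + 1 ≤ w) (x : Slice n w) :
    (Fintype.card (Slice n w) : ℝ) ≤ n.choose k * rowNorm n w k x := by
  induction k with
  | zero =>
    have : rowNorm n w 0 x = Fintype.card (Slice n w) := by
      simp [rowNorm, zonal, hahn_zero_left]
    simp [this]
  | succ k ih =>
    have ih := ih (by omega)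
    have e := down_mul_rowNorm h (by omega : k + 2 ≤ w) x
    have hu := up_pos h (by omega : k < w)
    have hd : 0 < down n w (k + 1 : ℕ) := by
      have h1 := rowNorm_pos (k + 1) x
      have h2 := rowNorm_pos k x
      by_contra hc
      have := mul_nonpos_of_nonpos_of_nonneg (not_lt.1 hc) h2.le
      rw [e] at this
      have := mul_pos hu h1
      linarith
    have hc := choose_mul_up_le h (by omega : k + 2 ≤ w)
    refine le_of_mul_le_mul_left ?_ hd
    calc down n w (k + 1 : ℕ) * (Fintype.card (Slice n w) : ℝ)
        ≤ down n w (k + 1 : ℕ) * (n.choose k * rowNorm n w k x) :=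
          mul_le_mul_of_nonneg_left ih hd.le
      _ = (n.choose k * up n w k) * rowNorm n w (k + 1) x := by
          linear_combination (n.choose k : ℝ) * e
      _ ≤ (n.choose (k + 1) * down n w (k + 1 : ℕ)) * rowNorm n w (k + 1) x :=
          mul_le_mul_of_nonneg_right hc (rowNorm_pos _ _).le
      _ = _ := by ring

/-- The zonal kernel with nonnegative coefficients `g 0, …, g t`. -/
noncomputable def combination (n w t : ℕ) (g : ℕ → ℝ) (x y : Slice n w) : ℝ :=
  ∑ k ∈ range (t + 1), g k * zonal n w k x y

theorem isGram_combination (h : 2 * w ≤ n) {t : ℕ} (ht : t ≤ w) {g : ℕ → ℝ}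
    (hg : ∀ k, k ≤ t → 0 ≤ g k) : IsGram (combination n w t g) :=
  IsGram.sum _ (fun k x y => g k * zonal n w k x y) fun k hk =>
    have hk : k ≤ t := Nat.lt_succ_iff.1 (mem_range.1 hk)
    (isGram_zonal h (hk.trans ht)).const_mul (hg k hk)

theorem sum_combination_sq (h : 2 * w ≤ n) {t : ℕ} (ht : t ≤ w) (g : ℕ → ℝ) (x : Slice n w) :
    ∑ y, combination n w t g x y ^ 2 = ∑ k ∈ range (t + 1), g k ^ 2 * rowNorm n w k x := by
  simp only [combination, sq, sum_mul_sum]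
  rw [sum_comm]
  refine sum_congr rfl fun k hk => ?_
  rw [sum_comm]
  have hk : k ≤ w := (Nat.lt_succ_iff.1 (mem_range.1 hk)).trans ht
  rw [sum_eq_single k]
  · rw [rowNorm, mul_sum]
    exact sum_congr rfl fun y _ => by ring
  · intro l hl hlk
    have hl : l ≤ w := (Nat.lt_succ_iff.1 (mem_range.1 hl)).trans ht
    have := sum_zonal_mul_zonal_row h hk hl hlk.symm x
    rw [← mul_zero (g k * g l), ← this, mul_sum]
    exact sum_congr rfl fun y _ => by ring
  · intro hk'
    exact absurd ‹k ∈ range (t + 1)› hk'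

theorem combination_comm (t : ℕ) (g : ℕ → ℝ) (x y : Slice n w) :
    combination n w t g x y = combination n w t g y x :=
  sum_congr rfl fun k _ => by rw [zonal_comm]

theorem combination_self (t : ℕ) (g : ℕ → ℝ) (x : Slice n w) :
    combination n w t g x x = ∑ k ∈ range (t + 1), g k := by
  simp [combination]

theorem sub_dist_mul_combination (h : 2 * w ≤ n) {t : ℕ} (ht : t + 1 ≤ w) {g : ℕ → ℝ}
    (g0 : g 0 = 0) (gt : ∀ k, t < k → g k = 0) (τ : ℝ) (x y : Slice n w) :
    (τ - dist x y) * combination n w t g x y =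
      g 1 * down n w (1 : ℕ) * zonal n w 0 x y + ∑ k ∈ range (t + 1),
        (g k * up n w k + (τ - up n w (k + 1 : ℕ) - down n w (k + 1 : ℕ)) * g (k + 1) +
          g (k + 2) * down n w (k + 2 : ℕ)) * zonal n w (k + 1) x y := by
  have e : (τ - dist x y) * combination n w t g x y = ∑ k ∈ range t, g (k + 1) *
      (up n w (k + 1 : ℕ) * zonal n w (k + 2) x y +
      (τ - up n w (k + 1 : ℕ) - down n w (k + 1 : ℕ)) * zonal n w (k + 1) x y +
      down n w (k + 1 : ℕ) * zonal n w k x y) := by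
    rw [combination, sum_range_succ', g0, zero_mul, add_zero, mul_sum]
    refine sum_congr rfl fun k hk => ?_
    have := neg_dist_mul_zonal h (by have := mem_range.1 hk; omega : 2 * (k + 1) < n) x y
    linear_combination g (k + 1) * this
  have a1 : ∑ k ∈ range (t + 1), g k * up n w k * zonal n w (k + 1) x y =
      ∑ k ∈ range t, g (k + 1) * up n w (k + 1 : ℕ) * zonal n w (k + 2) x y := by
    rw [sum_range_succ', g0]; simp
  have a2 : ∑ k ∈ range (t + 1), (τ - up n w (k + 1 : ℕ) - down n w (k + 1 : ℕ)) * g (k + 1) *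
      zonal n w (k + 1) x y = ∑ k ∈ range t, (τ - up n w (k + 1 : ℕ) - down n w (k + 1 : ℕ)) *
        g (k + 1) * zonal n w (k + 1) x y := by
    rw [sum_range_succ, gt (t + 1) (by omega)]; simp
  have a3 : g 1 * down n w (1 : ℕ) * zonal n w 0 x y + ∑ k ∈ range (t + 1),
      g (k + 2) * down n w (k + 2 : ℕ) * zonal n w (k + 1) x y =
      ∑ k ∈ range t, g (k + 1) * down n w (k + 1 : ℕ) * zonal n w k x y := by
    have : ∑ k ∈ range (t + 2), g (k + 1) * down n w (k + 1 : ℕ) * zonal n w k x y =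
        ∑ k ∈ range t, g (k + 1) * down n w (k + 1 : ℕ) * zonal n w k x y := by
      rw [sum_range_succ, sum_range_succ, gt (t + 1) (by omega), gt (t + 1 + 1) (by omega)]; simp
    rw [← this, sum_range_succ' _ (t + 1), add_comm]
  rw [e]
  simp only [add_mul, sum_add_distrib]
  rw [add_comm, add_assoc, add_comm _ (g 1 * _ * _), a1, a2, a3]
  simp only [← sum_add_distrib]
  exact sum_congr rfl fun k _ => by ring

/-- The linear programming bound for constant-weight codes, with a test kernel given by its
zonal coefficients. -/
theorem card_code_le (h : 2 * w ≤ n) {t : ℕ} (ht : t + 1 ≤ w) {g : ℕ → ℝ} (hg : ∀ k, 0 ≤ g k)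
    (g0 : g 0 = 0) (gt : ∀ k, t < k → g k = 0) (hpos : ∃ k, 0 < g k) {τ d : ℝ} (hτ : 0 ≤ τ)
    (hd : τ < d)
    (H : ∀ k ≤ t, 0 ≤ g k * up n w k + (τ - up n w (k + 1 : ℕ) - down n w (k + 1 : ℕ)) * g (k + 1) +
      g (k + 2) * down n w (k + 2 : ℕ))
    (C : Finset (Slice n w)) (hC : ∀ x ∈ C, ∀ y ∈ C, x ≠ y → d ≤ dist x y) :
    (C.card : ℝ) * (d - τ) ≤ d * ∑ k ∈ range (t + 1), (n.choose k : ℝ) := by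
  rcases C.eq_empty_or_nonempty with rfl | ⟨o, ho⟩
  · simp only [card_empty, Nat.cast_zero, zero_mul]
    exact mul_nonneg (hτ.trans hd.le) (sum_nonneg fun _ _ => by positivity)
  set G := combination n w t g
  set N := ∑ k ∈ range (t + 1), (n.choose k : ℝ)
  set X : ℝ := (Fintype.card (Slice n w) : ℝ)
  set Q := ∑ x ∈ C, ∑ y ∈ C, G x y * G x y
  set A := ∑ k ∈ range (t + 1), g k
  set r := ∑ y, G o y * G o y
  have hr : r = ∑ k ∈ range (t + 1), g k ^ 2 * rowNorm n w k o := by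
    rw [← sum_combination_sq h (by omega) g o]
    exact sum_congr rfl fun y _ => (sq _).symm
  have hrow : ∀ x, ∑ y, G x y * G x y = r := fun x =>
    sum_apply_dist_eq (fun j => (∑ k ∈ range (t + 1), g k * hahn n w k j) *
      ∑ k ∈ range (t + 1), g k * hahn n w k j) x o
  have hGram : IsGram G := isGram_combination h (by omega) fun k _ => hg k
  have hrpos : 0 < r := by
    obtain ⟨k, hk⟩ := hpos
    have hkt : k ≤ t := by
      by_contra hc
      rw [gt k (by omega)] at hk
      exact lt_irrefl _ hk
    rw [hr]
    exact sum_pos' (fun l _ => mul_nonneg (sq_nonneg _) (rowNorm_pos l o).le)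
      ⟨k, mem_range.2 (by omega), mul_pos (pow_pos hk 2) (rowNorm_pos k o)⟩
  -- Cauchy–Schwarz with weights `n.choose k`, followed by the multiplicity bound, compares the
  -- diagonal value `A` of `G` with the row sum `r` of `G ^ 2`.
  have step1 : A ^ 2 * X ≤ r * N := by
    have hX : 0 ≤ X := by positivity
    have cs : A ^ 2 ≤ (∑ k ∈ range (t + 1), g k ^ 2 / (n.choose k : ℝ)) * N := by
      have hc : ∀ k ∈ range (t + 1), 0 < (n.choose k : ℝ) := fun k hk => by
        have := mem_range.1 hk
        exact_mod_cast Nat.choose_pos (by omega)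
      refine sum_sq_le_sum_mul_sum_of_sq_le_mul _ (fun k hk => ?_) (fun k hk => (hc k hk).le)
        fun k hk => ?_
      · exact div_nonneg (sq_nonneg _) (hc k hk).le
      · exact (div_mul_cancel₀ _ (hc k hk).ne').ge
    have hN : 0 ≤ N := sum_nonneg fun _ _ => by positivity
    have : (∑ k ∈ range (t + 1), g k ^ 2 / (n.choose k : ℝ)) * X ≤ r := by
      rw [hr, sum_mul]
      refine sum_le_sum fun k hk => ?_
      have hk' := mem_range.1 hk
      have hc : 0 < (n.choose k : ℝ) := by exact_mod_cast Nat.choose_pos (by omega)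
      have := card_le_choose_mul_rowNorm h (by omega : k + 1 ≤ w) o
      rw [div_mul_eq_mul_div, div_le_iff₀ hc, mul_assoc]
      exact mul_le_mul_of_nonneg_left (by linarith) (sq_nonneg _)
    nlinarith [mul_le_mul_of_nonneg_right cs hX, mul_le_mul_of_nonneg_right this hN]
  have step2 : (C.card : ℝ) ^ 2 * r ≤ X * Q :=
    (hGram.mul hGram).le_sum_of_rowSum (fun x y => by simp only [G, combination_comm t g x y])
      hrow C
  -- Split `d - dist` as `(d - τ) + (τ - dist)`: the second part times `G * G` has a nonnegative sum
  -- over the code. In the full sum, off-diagonal terms are nonpositive by the distance condition,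
  -- so only the diagonal counts.
  have step3 : (d - τ) * Q ≤ C.card * (d * A ^ 2) := by
    have hH : IsGram fun x y => (τ - dist x y) * G x y := by
      simp only [G, sub_dist_mul_combination h ht g0 gt]
      refine ((isGram_zonal h (Nat.zero_le w)).const_mul ?_).add (IsGram.sum _
        (fun k x y => (g k * up n w k + (τ - up n w (k + 1 : ℕ) - down n w (k + 1 : ℕ)) * g (k + 1) +
          g (k + 2) * down n w (k + 2 : ℕ)) * zonal n w (k + 1) x y) fun k hk => ?_)
      · exact mul_nonneg (hg 1) (down_nonneg h (by omega))
      · have hk := mem_range.1 hk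
        exact (isGram_zonal h (by omega)).const_mul (H k (by omega))
    have hQ := (hH.mul hGram).sum_nonneg_of_finset C
    have e : ∑ x ∈ C, ∑ y ∈ C, (d - dist x y) * (G x y * G x y) =
        (d - τ) * Q + ∑ x ∈ C, ∑ y ∈ C, (τ - dist x y) * G x y * G x y := by
      simp only [Q, mul_sum, ← sum_add_distrib]
      exact sum_congr rfl fun x _ => sum_congr rfl fun y _ => by ring
    have le : ∑ x ∈ C, ∑ y ∈ C, (d - dist x y) * (G x y * G x y) ≤ ∑ x ∈ C, d * A ^ 2 := by
      refine sum_le_sum fun x hx => ?_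
      rw [← add_sum_erase C _ hx]
      have : ∑ y ∈ C.erase x, (d - dist x y) * (G x y * G x y) ≤ 0 := by
        refine sum_nonpos fun y hy => ?_
        have := hC x hx y (mem_of_mem_erase hy) (ne_of_mem_erase hy).symm
        exact mul_nonpos_of_nonpos_of_nonneg (by linarith) (mul_self_nonneg _)
      have e2 : (d - dist x x) * (G x x * G x x) = d * A ^ 2 := by
        simp only [G, combination_self, dist_self, A]
        push_cast
        ring
      linarith
    rw [sum_const, nsmul_eq_mul] at le
    linarith
  have hCpos : 0 < (C.card : ℝ) := by exact_mod_cast card_pos.2 ⟨o, ho⟩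
  have hX : 0 ≤ X := by positivity
  have f1 : (d - τ) * ((C.card : ℝ) ^ 2 * r) ≤ (d - τ) * (X * Q) :=
    mul_le_mul_of_nonneg_left step2 (by linarith)
  have f2 : X * ((d - τ) * Q) ≤ X * (C.card * (d * A ^ 2)) := mul_le_mul_of_nonneg_left step3 hX
  have f3 : (C.card : ℝ) * d * (A ^ 2 * X) ≤ C.card * d * (r * N) :=
    mul_le_mul_of_nonneg_left step1 (mul_nonneg hCpos.le (by linarith))
  have : (C.card * r) * (C.card * (d - τ)) ≤ (C.card * r) * (d * N) := by linarith
  exact le_of_mul_le_mul_left this (mul_pos hCpos hrpos)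

end Johnson

/-! ### Choice of the test kernel and asymptotics of the bound. -/

namespace Johnson

open Finset Slice

section Window

variable {n w : ℕ}

/-- The linear programming bound, in terms of bounds for the recurrence coefficients on a
window of indices. -/
theorem card_code_le_of_window (h : 2 * w ≤ n) {s L : ℕ} (hL : 1 ≤ L) (ht : s + L + 1 ≤ w)
    {ρ κ e τ d : ℝ} (hρ : 0 < ρ)
    (hup : ∀ k, s ≤ k → k ≤ s + L + 1 → ρ * κ ≤ up n w k)
    (hdown : ∀ k, s ≤ k → k ≤ s + L + 1 → κ / ρ ≤ down n w k)
    (hsum : ∀ k, s ≤ k → k ≤ s + L + 1 → up n w k + down n w k ≤ e)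
    (hτ : e - 2 * κ * Real.cos (Real.pi / (L + 1)) ≤ τ) (hτ0 : 0 ≤ τ) (hd : τ < d)
    (C : Finset (Slice n w)) (hC : ∀ x ∈ C, ∀ y ∈ C, x ≠ y → d ≤ dist x y) :
    (C.card : ℝ) * (d - τ) ≤ d * ∑ k ∈ range (s + L + 1), (n.choose k : ℝ) := by
  set θ := Real.pi / (L + 1)
  have hLpos : (0 : ℝ) < L + 1 := by positivity
  have hLθ : (L + 1) * θ = Real.pi := by simp only [θ]; field_simp
  have hθ : 0 < θ := div_pos Real.pi_pos hLpos
  have hsin : ∀ m : ℕ, m ≤ L + 1 → 0 ≤ Real.sin (m * θ) := fun m hm => by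
    apply Real.sin_nonneg_of_nonneg_of_le_pi (by positivity)
    rw [← hLθ]
    exact mul_le_mul_of_nonneg_right (by exact_mod_cast hm) hθ.le
  -- The sine is the top eigenvector of a path with `L` vertices, and the powers of `ρ` symmetrize
  -- the unequal upper and lower coefficients. It vanishes at both `m = 0` and `m = L + 1`, which
  -- agrees with the cutoff outside the window.
  let g : ℕ → ℝ := fun k => if k ≤ s + L then ρ ^ (k - s) * Real.sin ((k - s : ℕ) * θ) else 0
  have hg : ∀ k, 0 ≤ g k := fun k => by
    simp only [g]
    split_ifs with hk
    · exact mul_nonneg (by positivity) (hsin _ (by omega))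
    · exact le_rfl
  have g0 : ∀ k ≤ s, g k = 0 := fun k hk => by
    simp [g, Nat.sub_eq_zero_of_le hk]
  have gt : ∀ k, s + L < k → g k = 0 := fun k hk => by
    simp only [g]; rw [if_neg (by omega)]
  have gm : ∀ m ≤ L + 1, g (s + m) = ρ ^ m * Real.sin (m * θ) := fun m hm => by
    rcases Nat.lt_or_ge L m with h1 | h1
    · obtain rfl : m = L + 1 := by omega
      rw [gt _ (by omega)]
      push_cast
      rw [hLθ, Real.sin_pi, mul_zero]
    · simp only [g]
      rw [if_pos (by omega), Nat.add_sub_cancel_left]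
  refine card_code_le h ht hg (g0 0 (Nat.zero_le _)) gt ⟨s + 1, ?_⟩ hτ0 hd ?_ C hC
  · rw [gm 1 (by omega)]
    refine mul_pos (by positivity) (Real.sin_pos_of_pos_of_lt_pi (by simpa using hθ) ?_)
    rw [← hLθ]
    have : (1 : ℝ) ≤ L := by exact_mod_cast hL
    push_cast
    nlinarith
  · intro k hk
    have hup0 : 0 ≤ g k * up n w k := mul_nonneg (hg k) (up_pos h (by omega)).le
    have hdn0 : 0 ≤ g (k + 2) * down n w (k + 2 : ℕ) := by
      rcases le_or_gt (k + 2) w with h1 | h1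
      · exact mul_nonneg (hg _) (down_nonneg h h1)
      · rw [gt _ (by omega), zero_mul]
    rcases Nat.lt_or_ge k s with h1 | h1
    · rw [g0 (k + 1) (by omega), mul_zero, add_zero]
      exact add_nonneg hup0 hdn0
    · rcases hk.eq_or_lt with rfl | h2
      · rw [gt (s + L + 1) (by omega), mul_zero, add_zero]
        exact add_nonneg hup0 hdn0
      · obtain ⟨m, rfl⟩ := Nat.exists_eq_add_of_le h1
        have u := hup (s + m) (by omega) (by omega)
        have v := hsum (s + m + 1) (by omega) (by omega)
        have z := hdown (s + m + 2) (by omega) (by omega)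
        rw [gm m (by omega), show s + m + 1 = s + (m + 1) by ring, gm (m + 1) (by omega),
          show s + m + 2 = s + (m + 2) by ring, gm (m + 2) (by omega)]
        rw [show s + m + 1 = s + (m + 1) by ring] at v
        rw [show s + m + 2 = s + (m + 2) by ring] at z
        have s0 := hsin m (by omega)
        have s1 := hsin (m + 1) (by omega)
        have s2 := hsin (m + 2) (by omega)
        have trig : Real.sin (m * θ) + Real.sin ((m + 2 : ℕ) * θ) =
            2 * Real.cos θ * Real.sin ((m + 1 : ℕ) * θ) := by
          have e1 : (m : ℝ) * θ = (m + 1 : ℕ) * θ - θ := by push_cast; ring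
          have e2 : ((m + 2 : ℕ) : ℝ) * θ = (m + 1 : ℕ) * θ + θ := by push_cast; ring
          rw [e1, e2, Real.sin_sub, Real.sin_add]
          ring
        have hρm : 0 ≤ ρ ^ m := by positivity
        have i1 : ρ ^ (m + 1) * κ * Real.sin (m * θ) ≤
            ρ ^ m * Real.sin (m * θ) * up n w (s + m : ℕ) := by
          have := mul_le_mul_of_nonneg_left u (mul_nonneg hρm s0)
          rw [pow_succ]; linarith
        have i2 : ρ ^ (m + 1) * κ * Real.sin ((m + 2 : ℕ) * θ) ≤
            ρ ^ (m + 2) * Real.sin ((m + 2 : ℕ) * θ) * down n w (s + (m + 2) : ℕ) := by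
          have := mul_le_mul_of_nonneg_left z
            (mul_nonneg (by positivity : 0 ≤ ρ ^ (m + 2)) s2)
          have e : ρ ^ (m + 2) * Real.sin ((m + 2 : ℕ) * θ) * (κ / ρ) =
              ρ ^ (m + 1) * κ * Real.sin ((m + 2 : ℕ) * θ) := by
            rw [pow_succ ρ (m + 1)]
            field_simp
          linarith
        have i3 : (-(2 * κ * Real.cos θ)) * (ρ ^ (m + 1) * Real.sin ((m + 1 : ℕ) * θ)) ≤
            (τ - up n w (s + (m + 1) : ℕ) - down n w (s + (m + 1) : ℕ)) *
              (ρ ^ (m + 1) * Real.sin ((m + 1 : ℕ) * θ)) :=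
          mul_le_mul_of_nonneg_right (by linarith) (mul_nonneg (by positivity) s1)
        -- The lower bounds `i1`, `i2`, `i3` cancel exactly, by the addition formula `trig`.
        have e4 : ρ ^ (m + 1) * κ * Real.sin (m * θ) +
            (-(2 * κ * Real.cos θ)) * (ρ ^ (m + 1) * Real.sin ((m + 1 : ℕ) * θ)) +
            ρ ^ (m + 1) * κ * Real.sin ((m + 2 : ℕ) * θ) = 0 := by
          linear_combination ρ ^ (m + 1) * κ * trig
        linarith

end Window

section Asymptotics

open Filter Topology

theorem tendsto_floor_mul_div (a : ℝ) (ha : 0 ≤ a) :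
    Tendsto (fun n : ℕ => (⌊a * n⌋₊ : ℝ) / n) atTop (𝓝 a) :=
  (tendsto_nat_floor_mul_div_atTop ha).comp tendsto_natCast_atTop_atTop

theorem tendsto_up_div {a b : ℝ} (hb : b < 1 / 2) {w k : ℕ → ℕ}
    (hw : Tendsto (fun n => (w n : ℝ) / n) atTop (𝓝 a))
    (hk : Tendsto (fun n => (k n : ℝ) / n) atTop (𝓝 b)) :
    Tendsto (fun n : ℕ => up n (w n) (k n) / n) atTop
      (𝓝 ((a - b) * (1 - a - b) * (1 - b) / (1 - 2 * b) ^ 2)) := by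
  have h1 : Tendsto (fun n : ℕ => (1 : ℝ) / n) atTop (𝓝 0) := tendsto_one_div_atTop_nhds_zero_nat
  have h2 : (1 - 2 * b) * (1 + 0 - 2 * b) ≠ 0 := by
    have : 0 < 1 - 2 * b := by linarith
    rw [add_zero]; positivity
  have := (((hw.sub hk).mul ((hw.const_sub 1).sub hk)).mul ((h1.const_add 1).sub hk)).div
    (((hk.const_mul 2).const_sub 1).mul ((h1.const_add 1).sub (hk.const_mul 2))) h2
  rw [show (a - b) * (1 - a - b) * (1 - b) / (1 - 2 * b) ^ 2 =
    (a - b) * (1 - a - b) * (1 + 0 - b) / ((1 - 2 * b) * (1 + 0 - 2 * b)) by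
      rw [add_zero, sq]]
  refine this.congr' ?_
  filter_upwards [eventually_gt_atTop 0] with n hn
  have hn : (n : ℝ) ≠ 0 := by positivity
  have e : ∀ x y : ℝ, x / y / n = (x / n ^ 3) / (y / n ^ 2) := fun x y => by
    rcases eq_or_ne y 0 with rfl | hy
    · simp
    · field_simp
  simp only [Pi.div_apply]
  rw [up, e]
  congr 1 <;> field_simp

theorem tendsto_down_div {a b : ℝ} (hb : b < 1 / 2) {w k : ℕ → ℕ}
    (hw : Tendsto (fun n => (w n : ℝ) / n) atTop (𝓝 a))
    (hk : Tendsto (fun n => (k n : ℝ) / n) atTop (𝓝 b)) :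
    Tendsto (fun n : ℕ => down n (w n) (k n) / n) atTop
      (𝓝 (b * (1 - a - b) * (a - b) / (1 - 2 * b) ^ 2)) := by
  have h1 : Tendsto (fun n : ℕ => (1 : ℝ) / n) atTop (𝓝 0) := tendsto_one_div_atTop_nhds_zero_nat
  have h2 : (1 + 2 * 0 - 2 * b) * (1 + 0 - 2 * b) ≠ 0 := by
    have : 0 < 1 - 2 * b := by linarith
    rw [mul_zero, add_zero]; positivity
  have := ((hk.mul (((h1.const_add 1).sub hw).sub hk)).mul ((hw.add h1).sub hk)).div
    ((((h1.const_mul 2).const_add 1).sub (hk.const_mul 2)).mul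
      ((h1.const_add 1).sub (hk.const_mul 2))) h2
  rw [show b * (1 - a - b) * (a - b) / (1 - 2 * b) ^ 2 =
    b * (1 + 0 - a - b) * (a + 0 - b) / ((1 + 2 * 0 - 2 * b) * (1 + 0 - 2 * b)) by
      rw [mul_zero, add_zero, add_zero, sq]]
  refine this.congr' ?_
  filter_upwards [eventually_gt_atTop 0] with n hn
  have hn : (n : ℝ) ≠ 0 := by positivity
  have e : ∀ x y : ℝ, x / y / n = (x / n ^ 3) / (y / n ^ 2) := fun x y => by
    rcases eq_or_ne y 0 with rfl | hy
    · simp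
    · field_simp
  simp only [Pi.div_apply]
  rw [down, e]
  congr 1 <;> field_simp

/-- The asymptotic linear programming bound for constant-weight codes. -/
theorem eventually_card_code_le {a b : ℝ} (hb0 : 0 < b) (hba : b < a) (ha : a ≤ 1 / 2) {T : ℝ}
    (hT : (a * (1 - a) - b * (1 - b)) / (1 + 2 * √(b * (1 - b))) < T) :
    ∀ᶠ n : ℕ in atTop, ∀ C : Finset (Slice n ⌊a * n⌋₊),
      (∀ x ∈ C, ∀ y ∈ C, x ≠ y → n * T + 1 ≤ dist x y) →
      (C.card : ℝ) ≤ (n * T + 1) * ∑ k ∈ range (⌊b * n⌋₊ + 1), (n.choose k : ℝ) := by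
  set v := √(b * (1 - b))
  have hb1 : b < 1 / 2 := by linarith
  have hv0 : 0 < v := Real.sqrt_pos.2 (mul_pos hb0 (by linarith))
  have hvv : v * v = b * (1 - b) := Real.mul_self_sqrt (mul_pos hb0 (by linarith)).le
  set B := (a - b) * (1 - a - b) * (1 - b) / (1 - 2 * b) ^ 2
  set D := b * (1 - a - b) * (a - b) / (1 - 2 * b) ^ 2
  have h2b : 0 < 1 - 2 * b := by linarith
  have hab : 0 < (a - b) * (1 - a - b) := mul_pos (by linarith) (by linarith)
  -- `B` and `D` are the limits of `up / n` and `down / n`; `K` is their geometric mean and `ρ`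
  -- satisfies `ρ ^ 2 = B / D`. Thus `B + D - 2 * K` is the limiting threshold, and factoring `(1 -
  -- 2 * b) ^ 2` gives the required expression.
  set K := v * ((a - b) * (1 - a - b)) / (1 - 2 * b) ^ 2
  have hK : 0 < K := by positivity
  set ρ := (1 - b) / v
  have hρ : 0 < ρ := div_pos (by linarith) hv0
  have hB : ρ * K = B := by
    simp only [ρ, K, B]; field_simp
  have hD : K / ρ = D := by
    have : 1 - b ≠ 0 := by linarith
    simp only [ρ, K, D]; field_simp
    rw [sq, hvv]; ring
  have hval : B + D - 2 * K = (a * (1 - a) - b * (1 - b)) / (1 + 2 * v) := by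
    have h3 : (1 - 2 * b) ^ 2 = (1 - 2 * v) * (1 + 2 * v) := by linear_combination 4 * hvv
    have h4 : 0 < 1 + 2 * v := by linarith
    have h5 : 1 - 2 * v ≠ 0 := by
      intro hc
      rw [hc, zero_mul] at h3
      have : 0 < (1 - 2 * b) ^ 2 := by positivity
      linarith
    simp only [B, D, K]
    rw [h3]
    field_simp
    ring
  rw [← hval] at hT
  obtain ⟨η, hη, hTη⟩ : ∃ η > 0, B + D - 2 * K + 2 * η < T :=
    ⟨(T - (B + D - 2 * K)) / 4, by linarith, by linarith⟩
  have hT0 : 0 < T := by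
    have : 0 < (a * (1 - a) - b * (1 - b)) / (1 + 2 * v) :=
      div_pos (by nlinarith) (by linarith)
    linarith
  -- The window length is fixed before `n`. The cosine enters squared: once from the window bound
  -- and once because `κ = n * (K * c)` is taken below `n * K`, leaving room for convergence of the
  -- recurrence coefficients.
  obtain ⟨L, hL1, hL⟩ : ∃ L : ℕ, 1 ≤ L ∧
      2 * K * (1 - Real.cos (Real.pi / (L + 1)) ^ 2) < η := by
    have h1 : Tendsto (fun L : ℕ => Real.pi / ((L : ℝ) + 1)) atTop (𝓝 0) := by
      have := (tendsto_one_div_add_atTop_nhds_zero_nat (𝕜 := ℝ)).const_mul Real.pi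
      simpa [div_eq_mul_inv] using this
    have h2 : Tendsto (fun L : ℕ => 2 * K * (1 - Real.cos (Real.pi / ((L : ℝ) + 1)) ^ 2)) atTop
        (𝓝 (2 * K * (1 - Real.cos 0 ^ 2))) :=
      ((((Real.continuous_cos.tendsto 0).comp h1).pow 2).const_sub 1).const_mul (2 * K)
    simp only [Real.cos_zero, one_pow, sub_self, mul_zero] at h2
    exact ((eventually_ge_atTop 1).and (h2.eventually_lt_const hη)).exists
  set c := Real.cos (Real.pi / (L + 1))
  have hc0 : 0 ≤ c := by
    have hLr : (1 : ℝ) ≤ L := by exact_mod_cast hL1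
    apply Real.cos_nonneg_of_neg_pi_div_two_le_of_le
    · have : 0 ≤ Real.pi / ((L : ℝ) + 1) := by positivity
      linarith [Real.pi_pos]
    · exact div_le_div_of_nonneg_left Real.pi_pos.le (by norm_num) (by linarith)
  have hc1 : c < 1 := by
    have hLr : (1 : ℝ) ≤ L := by exact_mod_cast hL1
    rw [← Real.cos_zero]
    apply Real.cos_lt_cos_of_nonneg_of_le_pi le_rfl
    · exact div_le_self Real.pi_pos.le (by linarith)
    · exact div_pos Real.pi_pos (by linarith)
  have hBpos : 0 < B := by rw [← hB]; positivity
  have hDpos : 0 < D := by rw [← hD]; positivity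
  have hw := tendsto_floor_mul_div a (by linarith)
  have hk : ∀ i : ℕ, Tendsto (fun n : ℕ => ((⌊b * n⌋₊ - L + i : ℕ) : ℝ) / n) atTop (𝓝 b) := by
    intro i
    have h1 := tendsto_floor_mul_div b hb0.le
    have h2 : Tendsto (fun n : ℕ => ((i : ℝ) - L) / n) atTop (𝓝 0) :=
      tendsto_const_div_atTop_nhds_zero_nat _
    have h3 := h1.add h2
    rw [add_zero] at h3
    refine h3.congr' ?_
    have : Tendsto (fun n : ℕ => ⌊b * n⌋₊) atTop atTop :=
      tendsto_nat_floor_atTop.comp (tendsto_natCast_atTop_atTop.const_mul_atTop hb0)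
    filter_upwards [this.eventually_ge_atTop L] with n hn
    rw [← add_div]
    push_cast [Nat.cast_sub hn]
    ring
  have ev1 : ∀ i ∈ range (L + 2), ∀ᶠ n : ℕ in atTop,
      B * c < up n ⌊a * n⌋₊ (⌊b * n⌋₊ - L + i : ℕ) / n ∧
      D * c < down n ⌊a * n⌋₊ (⌊b * n⌋₊ - L + i : ℕ) / n ∧
      up n ⌊a * n⌋₊ (⌊b * n⌋₊ - L + i : ℕ) / n + down n ⌊a * n⌋₊ (⌊b * n⌋₊ - L + i : ℕ) / n <
        B + D + η := by
    intro i _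
    have hu := tendsto_up_div hb1 hw (hk i)
    have hd := tendsto_down_div hb1 hw (hk i)
    exact (hu.eventually_const_lt (by nlinarith)).and ((hd.eventually_const_lt (by nlinarith)).and
      ((hu.add hd).eventually_lt_const (by linarith)))
  have ev2 := (eventually_all_finset (range (L + 2))).2 ev1
  have ev3 : ∀ᶠ n : ℕ in atTop, L ≤ ⌊b * n⌋₊ :=
    (tendsto_nat_floor_atTop.comp
      (tendsto_natCast_atTop_atTop.const_mul_atTop hb0)).eventually_ge_atTop L
  have ev4 : ∀ᶠ n : ℕ in atTop, ⌊b * n⌋₊ + 1 ≤ ⌊a * n⌋₊ := by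
    have : Tendsto (fun n : ℕ => (a - b) * n) atTop atTop :=
      tendsto_natCast_atTop_atTop.const_mul_atTop (by linarith)
    filter_upwards [this.eventually_ge_atTop 1] with n hn
    apply Nat.le_floor
    have := Nat.floor_le (by positivity : 0 ≤ b * n)
    push_cast
    linarith
  filter_upwards [ev2, ev3, ev4, eventually_gt_atTop 0] with n h2 h3 h4 hn C hC
  have hnr : (0 : ℝ) < n := by exact_mod_cast hn
  have hwn : 2 * ⌊a * n⌋₊ ≤ n := by
    have := Nat.floor_le (mul_nonneg (hb0.trans hba).le hnr.le : 0 ≤ a * n)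
    have h5 : (2 : ℝ) * ⌊a * n⌋₊ ≤ n := by nlinarith
    exact_mod_cast h5
  have hi : ∀ k, ⌊b * n⌋₊ - L ≤ k → k ≤ ⌊b * n⌋₊ - L + L + 1 →
      n * (B * c) < up n ⌊a * n⌋₊ k ∧ n * (D * c) < down n ⌊a * n⌋₊ k ∧
      up n ⌊a * n⌋₊ k + down n ⌊a * n⌋₊ k < n * (B + D + η) := by
    intro k hk1 hk2
    obtain ⟨i, rfl⟩ := Nat.exists_eq_add_of_le hk1
    obtain ⟨q1, q2, q3⟩ := h2 i (mem_range.2 (by omega))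
    rw [lt_div_iff₀' hnr] at q1 q2
    rw [← add_div, div_lt_iff₀' hnr] at q3
    exact ⟨q1, q2, q3⟩
  have main := card_code_le_of_window hwn (s := ⌊b * n⌋₊ - L) (L := L) hL1 (by omega) (ρ := ρ)
    (κ := n * (K * c)) (e := n * (B + D + η)) (τ := n * T) (d := n * T + 1) hρ
    (fun k k1 k2 => by
      have := (hi k k1 k2).1
      rw [← hB] at this
      linarith)
    (fun k k1 k2 => by
      have := (hi k k1 k2).2.1
      rw [← hD] at this
      have e : n * (K / ρ * c) = n * (K * c) / ρ := by ring
      linarith)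
    (fun k k1 k2 => (hi k k1 k2).2.2.le)
    (by
      have : n * (B + D + η - 2 * K * c ^ 2) ≤ n * T :=
        mul_le_mul_of_nonneg_left (by linarith) hnr.le
      linarith)
    (by positivity) (by linarith) C hC
  rw [Nat.sub_add_cancel h3] at main
  linarith

end Asymptotics

/-! ### Entropy estimates for binomial coefficients. -/

section Entropy

variable {n w : ℕ}

/-- The entropy bound for the volume of a Hamming ball. -/
theorem sum_choose_le_exp {b : ℝ} (hb0 : 0 < b) (hb1 : b ≤ 1 / 2) {t : ℕ} (ht : (t : ℝ) ≤ b * n) :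
    ∑ k ∈ range (t + 1), (n.choose k : ℝ) ≤ Real.exp (n * Real.binEntropy b) := by
  have h1b : 0 < 1 - b := by linarith
  have htn : t ≤ n := by
    have : (t : ℝ) ≤ n := ht.trans (by nlinarith [(Nat.cast_nonneg n : (0 : ℝ) ≤ n)])
    exact_mod_cast this
  have hE : Real.exp (-(n * Real.binEntropy b)) =
      Real.exp (b * n * Real.log b + (n - b * n) * Real.log (1 - b)) := by
    congr 1
    rw [Real.binEntropy, Real.log_inv, Real.log_inv]
    ring
  -- For `k ≤ b * n` and `b ≤ 1 / 2`, the Bernoulli weight of a word with `k` ones is at least its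
  -- value at `k = b * n`, which is `exp (-n H(b))`.
  have hterm : ∀ k ∈ range (t + 1), (n.choose k : ℝ) * Real.exp (-(n * Real.binEntropy b)) ≤
      b ^ k * (1 - b) ^ (n - k) * n.choose k := by
    intro k hk
    have hk : k ≤ t := Nat.lt_succ_iff.1 (mem_range.1 hk)
    have e : b ^ k * (1 - b) ^ (n - k) =
        Real.exp (k * Real.log b + (n - k) * Real.log (1 - b)) := by
      rw [Real.exp_add, ← Nat.cast_sub (hk.trans htn), Real.exp_nat_mul, Real.exp_nat_mul,
        Real.exp_log hb0, Real.exp_log h1b]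
    rw [e, mul_comm, hE]
    refine mul_le_mul_of_nonneg_right (Real.exp_le_exp.2 ?_) (by positivity)
    have hlog : Real.log b ≤ Real.log (1 - b) := Real.log_le_log hb0 (by linarith)
    have hkb : (k : ℝ) ≤ b * n := le_trans (by exact_mod_cast hk) ht
    nlinarith
  have hsum : (∑ k ∈ range (t + 1), (n.choose k : ℝ)) * Real.exp (-(n * Real.binEntropy b)) ≤ 1 := by
    rw [sum_mul]
    calc _ ≤ ∑ k ∈ range (t + 1), b ^ k * (1 - b) ^ (n - k) * n.choose k := sum_le_sum hterm
      _ ≤ ∑ k ∈ range (n + 1), b ^ k * (1 - b) ^ (n - k) * n.choose k :=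
          sum_le_sum_of_subset_of_nonneg (by
            intro k hk
            have := mem_range.1 hk
            exact mem_range.2 (by omega)) fun k _ _ => by positivity
      _ = 1 := by rw [← add_pow]; simp
  rw [Real.exp_neg, ← div_eq_mul_inv, div_le_one (Real.exp_pos _)] at hsum
  exact hsum

/-- The mode of a binomial distribution with integral mean. -/
theorem choose_mul_pow_le (hw : w ≤ n) {k : ℕ} (hk : k ≤ n) :
    n.choose k * (w ^ k * (n - w) ^ (n - k)) ≤ n.choose w * (w ^ w * (n - w) ^ (n - w)) := by
  rcases le_total k w with hkw | hkw
  · induction hkw using Nat.decreasingInduction with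
    | self => exact le_rfl
    | of_succ k hk' ih =>
      refine le_trans ?_ (ih (by omega))
      have e := Nat.choose_succ_right_eq n k
      have key : n.choose k * (n - w) ≤ n.choose (k + 1) * w := by
        apply Nat.le_of_mul_le_mul_right _ (Nat.succ_pos k)
        calc n.choose k * (n - w) * (k + 1) = n.choose k * ((n - w) * (k + 1)) := by ring
          _ ≤ n.choose k * ((n - k) * w) :=
              Nat.mul_le_mul_left _ (Nat.mul_le_mul (by omega) (by omega))
          _ = n.choose (k + 1) * w * (k + 1) := by rw [← mul_assoc, ← e]; ring
      rw [show n - k = n - (k + 1) + 1 by omega, pow_succ, pow_succ]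
      calc _ = (n.choose k * (n - w)) * (w ^ k * (n - w) ^ (n - (k + 1))) := by ring
        _ ≤ (n.choose (k + 1) * w) * (w ^ k * (n - w) ^ (n - (k + 1))) :=
            Nat.mul_le_mul_right _ key
        _ = _ := by ring
  · induction k, hkw using Nat.le_induction with
    | base => exact le_rfl
    | succ k hk' ih =>
      refine le_trans ?_ (ih (by omega))
      have e := Nat.choose_succ_right_eq n k
      have key : n.choose (k + 1) * w ≤ n.choose k * (n - w) := by
        apply Nat.le_of_mul_le_mul_right _ (Nat.succ_pos k)
        calc n.choose (k + 1) * w * (k + 1) = n.choose k * ((n - k) * w) := by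
              rw [← mul_assoc, ← e]; ring
          _ ≤ n.choose k * ((n - w) * (k + 1)) :=
              Nat.mul_le_mul_left _ (Nat.mul_le_mul (by omega) (by omega))
          _ = n.choose k * (n - w) * (k + 1) := by ring
      rw [show n - k = n - (k + 1) + 1 by omega, pow_succ, pow_succ]
      calc _ = (n.choose (k + 1) * w) * (w ^ k * (n - w) ^ (n - (k + 1))) := by ring
        _ ≤ (n.choose k * (n - w)) * (w ^ k * (n - w) ^ (n - (k + 1))) :=
            Nat.mul_le_mul_right _ key
        _ = _ := by ring

/-- The entropy lower bound for a binomial coefficient. -/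
theorem exp_le_choose (hw0 : 0 < w) (hw : w < n) :
    Real.exp (n * Real.binEntropy (w / n)) ≤ (n + 1) * n.choose w := by
  -- Expand `(w + (n - w)) ^ n`: the term of index `w` is the largest of the `n + 1` terms.
  have h1 : n ^ n ≤ (n + 1) * (n.choose w * (w ^ w * (n - w) ^ (n - w))) := by
    calc n ^ n = (w + (n - w)) ^ n := by rw [Nat.add_sub_cancel' hw.le]
      _ = ∑ k ∈ range (n + 1), w ^ k * (n - w) ^ (n - k) * n.choose k := add_pow _ _ _
      _ ≤ ∑ k ∈ range (n + 1), n.choose w * (w ^ w * (n - w) ^ (n - w)) :=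
          sum_le_sum fun k hk => by
            rw [mul_comm]
            exact choose_mul_pow_le hw.le (Nat.lt_succ_iff.1 (mem_range.1 hk))
      _ = _ := by simp
  have hn : (0 : ℝ) < n := by exact_mod_cast hw0.trans hw
  have hw0' : (0 : ℝ) < w := by exact_mod_cast hw0
  have hnw : (0 : ℝ) < n - w := sub_pos.2 (by exact_mod_cast hw)
  have h2 : (n : ℝ) ^ n ≤ ((n + 1) * n.choose w) * ((w : ℝ) ^ w * ((n : ℝ) - w) ^ (n - w)) := by
    rw [← Nat.cast_sub hw.le]
    have : ((n ^ n : ℕ) : ℝ) ≤ ((n + 1) * (n.choose w * (w ^ w * (n - w) ^ (n - w))) : ℕ) := by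
      exact_mod_cast h1
    push_cast at this ⊢
    linarith
  have e : Real.exp (n * Real.binEntropy (w / n)) * ((w : ℝ) ^ w * ((n : ℝ) - w) ^ (n - w)) =
      (n : ℝ) ^ n := by
    have p : ∀ (x : ℝ) (m : ℕ), 0 < x → x ^ m = Real.exp (m * Real.log x) := fun x m hx => by
      rw [Real.exp_nat_mul, Real.exp_log hx]
    rw [p _ _ hn, p _ _ hw0', p _ _ hnw, ← Real.exp_add, ← Real.exp_add, Nat.cast_sub hw.le]
    congr 1
    have e1 : (1 : ℝ) - w / n = (n - w) / n := by field_simp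
    rw [Real.binEntropy, e1, Real.log_inv, Real.log_inv, Real.log_div hw0'.ne' hn.ne',
      Real.log_div hnw.ne' hn.ne']
    field_simp
    ring
  rw [← e] at h2
  exact le_of_mul_le_mul_right h2 (by positivity)

end Entropy

end Johnson

/-! ### From close constant-weight words to the error probability of the channel. -/

namespace Typewriter

open Finset Johnson Johnson.Slice

section Channel

variable {q : ℕ} {ε : ℝ}

theorem natCast_ne_zero_of_lt {m : ℕ} (hm : 0 < m) (hmq : m < q) : (m : ZMod q) ≠ 0 := by
  rw [Ne, ZMod.natCast_eq_zero_iff]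
  exact fun h => absurd (Nat.le_of_dvd hm h) (by omega)

theorem zmod_one_ne_zero (hq : 4 ≤ q) : (1 : ZMod q) ≠ 0 := by
  simpa using natCast_ne_zero_of_lt (q := q) one_pos (by omega)

theorem add_one_add_one_ne (hq : 4 ≤ q) (x : ZMod q) : x + 1 + 1 ≠ x := by
  have h : ((2 : ℕ) : ZMod q) ≠ 0 := natCast_ne_zero_of_lt two_pos (by omega)
  intro hx
  apply h
  push_cast
  linear_combination hx

theorem add_one_ne (hq : 4 ≤ q) (x : ZMod q) : x + 1 ≠ x := by
  simpa using zmod_one_ne_zero hq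

theorem W_nonneg (h0 : 0 < ε) (h1 : ε ≤ 1 / 2) (x y : ZMod q) : 0 ≤ W q ε x y := by
  unfold W
  split_ifs <;> linarith

theorem Wn_nonneg (h0 : 0 < ε) (h1 : ε ≤ 1 / 2) {n : ℕ} (x y : Fin n → ZMod q) :
    0 ≤ Wn q ε x y := prod_nonneg fun _ _ => W_nonneg h0 h1 _ _

theorem W_self (x : ZMod q) : W q ε x x = 1 - ε := by simp [W]

theorem W_add_one (hq : 4 ≤ q) (x : ZMod q) : W q ε x (x + 1) = ε := by
  rw [W, if_neg (add_one_ne hq x), if_pos rfl]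

theorem eq_or_eq_of_W_ne_zero {x y : ZMod q} (h : W q ε x y ≠ 0) : y = x ∨ y = x + 1 := by
  by_contra hc
  rw [not_or] at hc
  exact h (by rw [W, if_neg hc.1, if_neg hc.2])

theorem sum_sqrt_W_self [NeZero q] (hq : 4 ≤ q) (h0 : 0 < ε) (h1 : ε ≤ 1 / 2) (x : ZMod q) :
    ∑ y, √(W q ε x y * W q ε x y) = 1 := by
  have : ∀ y, √(W q ε x y * W q ε x y) =
      (if y = x then 1 - ε else 0) + (if y = x + 1 then ε else 0) := fun y => by
    rw [Real.sqrt_mul_self (W_nonneg h0 h1 x y), W]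
    by_cases hy : y = x
    · subst hy
      simp [(add_one_ne hq y).symm]
    · simp [hy]
  simp [this, sum_add_distrib]

theorem sum_sqrt_W_add_one [NeZero q] (hq : 4 ≤ q) (x : ZMod q) :
    ∑ y, √(W q ε x y * W q ε (x + 1) y) = alphaEps ε := by
  rw [sum_eq_single (x + 1)]
  · rw [W_add_one hq, W_self, alphaEps]
  · intro y _ hy
    have : W q ε x y * W q ε (x + 1) y = 0 := by
      by_contra hc
      rcases eq_or_eq_of_W_ne_zero (left_ne_zero_of_mul hc) with rfl | h
      · rcases eq_or_eq_of_W_ne_zero (right_ne_zero_of_mul hc) with h | h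
        · exact add_one_ne hq y h.symm
        · exact add_one_add_one_ne hq y h.symm
      · exact hy h
    rw [this, Real.sqrt_zero]
  · simp

/-- The binary word with support `z`. -/
def word (q : ℕ) {n w : ℕ} (z : Slice n w) (i : Fin n) : ZMod q := if i ∈ z.1 then 1 else 0

theorem word_injective (hq : 4 ≤ q) {n w : ℕ} :
    Function.Injective (word q : Slice n w → Fin n → ZMod q) := by
  intro z z' h
  apply Subtype.ext
  ext i
  have := congrFun h i
  have h1 := zmod_one_ne_zero hq
  simp only [word] at this
  split_ifs at this with a b b
  · simp [a, b]
  · exact absurd this h1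
  · exact absurd this.symm h1
  · simp [a, b]

variable {n w : ℕ}

/-- Where the two words disagree, a common output must be `a + 1`, so the likelihoods there are `ε`
and `1 - ε`. The balancing factors depend only on membership and multiply to the same constant for
all words of weight `w`. -/
theorem W_mul_eq (hq : 4 ≤ q) (a : ZMod q) (z z' : Slice n w) (i : Fin n) (y : ZMod q)
    (h : W q ε (a + word q z i) y ≠ 0) (h' : W q ε (a + word q z' i) y ≠ 0) :
    W q ε (a + word q z i) y * ((if i ∈ z.1 then ε else 1) * (if i ∈ z'.1 then 1 - ε else 1)) =
      W q ε (a + word q z' i) y *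
        ((if i ∈ z'.1 then ε else 1) * (if i ∈ z.1 then 1 - ε else 1)) := by
  have key : ∀ y : ZMod q, W q ε a y ≠ 0 → W q ε (a + 1) y ≠ 0 → y = a + 1 := by
    intro y h h'
    rcases eq_or_eq_of_W_ne_zero h with rfl | h
    · rcases eq_or_eq_of_W_ne_zero h' with h | h
      · exact absurd h.symm (add_one_ne hq y)
      · exact absurd h.symm (add_one_add_one_ne hq y)
    · exact h
  by_cases h1 : i ∈ z.1 <;> by_cases h2 : i ∈ z'.1 <;>
    simp only [word, h1, h2, if_true, if_false, add_zero] at h h' ⊢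
  · rw [key y h' h, W_self, W_add_one hq]; ring
  · rw [key y h h', W_self, W_add_one hq]; ring

theorem prod_ite_mem_slice (z : Slice n w) (c : ℝ) : ∏ i, (if i ∈ z.1 then c else 1) = c ^ w := by
  rw [prod_ite_mem, univ_inter, prod_const, z.2]

/-- Words of equal weight are equally likely to produce a common output. -/
theorem Wn_eq_of_ne_zero (hq : 4 ≤ q) (h0 : 0 < ε) (h1 : ε ≤ 1 / 2) (a y : Fin n → ZMod q)
    (z z' : Slice n w) (h : Wn q ε (a + word q z) y ≠ 0) (h' : Wn q ε (a + word q z') y ≠ 0) :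
    Wn q ε (a + word q z) y = Wn q ε (a + word q z') y := by
  have e : Wn q ε (a + word q z) y * (ε ^ w * (1 - ε) ^ w) =
      Wn q ε (a + word q z') y * (ε ^ w * (1 - ε) ^ w) := by
    conv_lhs => rw [← prod_ite_mem_slice z ε, ← prod_ite_mem_slice z' (1 - ε)]
    conv_rhs => rw [← prod_ite_mem_slice z' ε, ← prod_ite_mem_slice z (1 - ε)]
    simp only [Wn, ← prod_mul_distrib]
    refine prod_congr rfl fun i _ => ?_
    exact W_mul_eq hq (a i) z z' i (y i) (prod_ne_zero_iff.1 h i (mem_univ i))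
      (prod_ne_zero_iff.1 h' i (mem_univ i))
  have : 0 < 1 - ε := by linarith
  exact mul_right_cancel₀ (by positivity) e

theorem prod_sqrt_le_min (hq : 4 ≤ q) (h0 : 0 < ε) (h1 : ε ≤ 1 / 2) (a y : Fin n → ZMod q)
    (z z' : Slice n w) :
    ∏ i, √(W q ε ((a + word q z) i) (y i) * W q ε ((a + word q z') i) (y i)) ≤
      min (Wn q ε (a + word q z) y) (Wn q ε (a + word q z') y) := by
  set V := Wn q ε (a + word q z) y
  set V' := Wn q ε (a + word q z') y
  have hV : 0 ≤ V := Wn_nonneg h0 h1 _ _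
  have hV' : 0 ≤ V' := Wn_nonneg h0 h1 _ _
  set S := ∏ i, √(W q ε ((a + word q z) i) (y i) * W q ε ((a + word q z') i) (y i))
  have hS : 0 ≤ S := prod_nonneg fun _ _ => Real.sqrt_nonneg _
  have hSS : S * S = V * V' := by
    simp only [S, V, V', Wn, ← prod_mul_distrib]
    exact prod_congr rfl fun i _ =>
      Real.mul_self_sqrt (mul_nonneg (W_nonneg h0 h1 _ _) (W_nonneg h0 h1 _ _))
  by_cases hz : V * V' = 0
  · rw [hz, mul_self_eq_zero] at hSS
    rw [hSS]
    exact le_min hV hV'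
  · have := Wn_eq_of_ne_zero hq h0 h1 a y z z' (left_ne_zero_of_mul hz) (right_ne_zero_of_mul hz)
    change V = V' at this
    rw [← this] at hSS ⊢
    rw [min_self]
    exact (mul_self_le_mul_self_iff hS hV).2 hSS.le

/-- The sum of the products of square roots factors over coordinates: each factor is `1` where the
words agree and `α_ε` where they differ, and they differ in `2 * dist z z'` places. -/
theorem pow_le_sum_min [NeZero q] (hq : 4 ≤ q) (h0 : 0 < ε) (h1 : ε ≤ 1 / 2)
    (a : Fin n → ZMod q) (z z' : Slice n w) :
    alphaEps ε ^ (2 * dist z z') ≤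
      ∑ y, min (Wn q ε (a + word q z) y) (Wn q ε (a + word q z') y) := by
  refine le_trans (le_of_eq ?_) (sum_le_sum fun y _ => prod_sqrt_le_min hq h0 h1 a y z z')
  have e := prod_univ_sum (fun _ : Fin n => (univ : Finset (ZMod q)))
    (fun i y => √(W q ε ((a + word q z) i) y * W q ε ((a + word q z') i) y))
  rw [Fintype.piFinset_univ] at e
  rw [← e]
  have hc : ∀ i, ∑ y, √(W q ε ((a + word q z) i) y * W q ε ((a + word q z') i) y) =
      (if i ∈ z.1 \ z'.1 then alphaEps ε else 1) * (if i ∈ z'.1 \ z.1 then alphaEps ε else 1) := by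
    intro i
    by_cases h2 : i ∈ z.1 <;> by_cases h3 : i ∈ z'.1 <;>
      simp only [Pi.add_apply, word, h2, h3, mem_sdiff, if_true, if_false, add_zero, not_true,
        not_false_iff, and_true, and_false, mul_one, one_mul]
    · exact sum_sqrt_W_self hq h0 h1 _
    · simp only [fun y => mul_comm (W q ε (a i + 1) y), sum_sqrt_W_add_one hq]
    · exact sum_sqrt_W_add_one hq _
    · exact sum_sqrt_W_self hq h0 h1 _
  simp only [hc, prod_mul_distrib, prod_ite_mem, univ_inter, prod_const]
  have := dist_comm z z'
  rw [two_mul, pow_add]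
  nth_rewrite 2 [this]
  rfl

/-- Probability of error when the codeword `c m` is sent. -/
noncomputable def msgError (q : ℕ) [NeZero q] (ε : ℝ) {M n : ℕ} (c : Fin M → Fin n → ZMod q)
    (dec : (Fin n → ZMod q) → Fin M) (m : Fin M) : ℝ :=
  ∑ y, if dec y = m then 0 else Wn q ε (c m) y

theorem msgError_nonneg [NeZero q] (h0 : 0 < ε) (h1 : ε ≤ 1 / 2) {M : ℕ}
    (c : Fin M → Fin n → ZMod q) (dec : (Fin n → ZMod q) → Fin M) (m : Fin M) :
    0 ≤ msgError q ε c dec m :=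
  sum_nonneg fun y _ => by
    split_ifs
    · exact le_rfl
    · exact Wn_nonneg h0 h1 _ _

/-- Each output is decoded wrongly for at least one of the two messages, and so costs at least the
smaller likelihood. -/
theorem sum_min_le_msgError_add [NeZero q] (h0 : 0 < ε) (h1 : ε ≤ 1 / 2) {M : ℕ}
    (c : Fin M → Fin n → ZMod q) (dec : (Fin n → ZMod q) → Fin M) {m m' : Fin M} (hm : m ≠ m') :
    ∑ y, min (Wn q ε (c m) y) (Wn q ε (c m') y) ≤
      msgError q ε c dec m + msgError q ε c dec m' := by
  rw [msgError, msgError, ← sum_add_distrib]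
  refine sum_le_sum fun y _ => ?_
  have a1 := Wn_nonneg (q := q) h0 h1 (c m) y
  have a2 := Wn_nonneg (q := q) h0 h1 (c m') y
  by_cases hy : dec y = m
  · rw [if_pos hy, if_neg (fun h => hm (hy.symm.trans h)), zero_add]
    exact min_le_right _ _
  · rw [if_neg hy]
    refine (min_le_left _ _).trans (le_add_of_nonneg_right ?_)
    split_ifs
    · exact le_rfl
    · exact a2

/-- At least half of the messages have error probability at most twice the average. -/
theorem le_two_mul_card_filter [NeZero q] (h0 : 0 < ε) (h1 : ε ≤ 1 / 2) {M : ℕ} (hM : 1 ≤ M)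
    (c : Fin M → Fin n → ZMod q) (dec : (Fin n → ZMod q) → Fin M) :
    (M : ℝ) ≤ 2 * (univ.filter fun m => msgError q ε c dec m ≤ 2 * avgError q ε c dec).card := by
  set P := avgError q ε c dec
  set T := univ.filter fun m => msgError q ε c dec m ≤ 2 * P
  have hMr : (0 : ℝ) < M := by exact_mod_cast hM
  have hP : (M : ℝ) * P = ∑ m, msgError q ε c dec m := by
    simp only [P, avgError, msgError]
    rw [← mul_assoc, mul_one_div_cancel hMr.ne', one_mul]
  have hP0 : 0 ≤ P := by
    have : 0 ≤ (M : ℝ) * P := by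
      rw [hP]; exact sum_nonneg fun m _ => msgError_nonneg h0 h1 c dec m
    exact nonneg_of_mul_nonneg_right this hMr
  rcases hP0.eq_or_lt with hz | hpos
  · rw [← hz, mul_zero] at hP
    have hall := (sum_eq_zero_iff_of_nonneg fun m _ => msgError_nonneg h0 h1 c dec m).1 hP.symm
    have : T = univ := by
      ext m
      simp [T, hall m (mem_univ m), ← hz]
    rw [this, card_univ, Fintype.card_fin]
    linarith
  · have hc : (Tᶜ.card : ℝ) * (2 * P) ≤ M * P := by
      rw [hP, ← nsmul_eq_mul]
      refine (card_nsmul_le_sum Tᶜ (fun m => msgError q ε c dec m) _ fun m hm => ?_).trans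
        (sum_le_univ_sum_of_nonneg fun m => msgError_nonneg h0 h1 c dec m)
      have : ¬ msgError q ε c dec m ≤ 2 * P := by simpa [T] using hm
      linarith
    have hT : (Tᶜ.card : ℝ) + T.card = M := by
      have := card_compl_add_card T
      rw [Fintype.card_fin] at this
      exact_mod_cast this
    have h3 : (Tᶜ.card : ℝ) * 2 ≤ M := by
      refine le_of_mul_le_mul_right ?_ hpos
      linarith
    linarith

/-- A bound on the size of constant-weight codes yields a lower bound on the probability of
error over the typewriter channel. -/
theorem exists_pow_le_avgError [NeZero q] (hq : 4 ≤ q) (h0 : 0 < ε) (h1 : ε ≤ 1 / 2) {M : ℕ}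
    (hM : 1 ≤ M) (c : Fin M → Fin n → ZMod q) (dec : (Fin n → ZMod q) → Fin M) {d K : ℝ}
    (hd : 0 < d)
    (hK : ∀ C : Finset (Slice n w), (∀ x ∈ C, ∀ y ∈ C, x ≠ y → d ≤ dist x y) → (C.card : ℝ) ≤ K)
    (hlt : 2 * ((q : ℝ) ^ n * K) < M * n.choose w) :
    ∃ j : ℕ, (j : ℝ) < d ∧ alphaEps ε ^ (2 * j) ≤ 4 * avgError q ε c dec := by
  classical
  set T := univ.filter fun m => msgError q ε c dec m ≤ 2 * avgError q ε c dec
  have hT : (M : ℝ) ≤ 2 * T.card := le_two_mul_card_filter h0 h1 hM c dec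
  have hcard : Fintype.card (Slice n w) = n.choose w := by
    rw [Fintype.card_finset_len, Fintype.card_fin]
  have hpig : ((univ : Finset (Fin n → ZMod q)).card) • K <
      ((T ×ˢ (univ : Finset (Slice n w))).card : ℝ) := by
    rw [card_product, card_univ, card_univ, hcard, Fintype.card_fun, ZMod.card, Fintype.card_fin,
      nsmul_eq_mul]
    push_cast
    have : (M : ℝ) * n.choose w ≤ 2 * T.card * n.choose w :=
      mul_le_mul_of_nonneg_right hT (by positivity)
    linarith
  obtain ⟨a, -, ha⟩ := exists_lt_card_fiber_of_nsmul_lt_card_of_maps_to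
    (f := fun p : Fin M × Slice n w => c p.1 - word q p.2) (fun p _ => mem_univ _) hpig
  set F := (T ×ˢ (univ : Finset (Slice n w))).filter fun p => c p.1 - word q p.2 = a
  have hF : ∀ p ∈ F, p.1 ∈ T ∧ c p.1 = a + word q p.2 := by
    intro p hp
    simp only [F, mem_filter, mem_product] at hp
    exact ⟨hp.1.1, sub_eq_iff_eq_add.1 hp.2⟩
  obtain ⟨p, hp, p', hp', hne, hdist⟩ : ∃ p ∈ F, ∃ p' ∈ F, p.1 ≠ p'.1 ∧
      (dist p.2 p'.2 : ℝ) < d := by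
    -- If distinct pairs in the fibre have distinct subsets, these form a code larger than `K`,
    -- hence with a close pair. Otherwise two messages share a codeword and the distance is zero.
    by_cases hinj : Set.InjOn Prod.snd (F : Set (Fin M × Slice n w))
    · have hbig : K < ((F.image Prod.snd).card : ℝ) := by rwa [card_image_of_injOn hinj]
      have hnot : ¬ ∀ x ∈ F.image Prod.snd, ∀ y ∈ F.image Prod.snd, x ≠ y → d ≤ dist x y :=
        fun h => absurd (hK _ h) (not_le.2 hbig)
      push Not at hnot
      obtain ⟨x, hx, y, hy, hxy, hlt⟩ := hnot
      obtain ⟨p, hp, rfl⟩ := mem_image.1 hx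
      obtain ⟨p', hp', rfl⟩ := mem_image.1 hy
      refine ⟨p, hp, p', hp', fun he => hxy ?_, hlt⟩
      have e1 := (hF p hp).2
      have e2 := (hF p' hp').2
      rw [he, e2] at e1
      exact (word_injective hq (add_left_cancel e1)).symm
    · simp only [Set.InjOn] at hinj
      push Not at hinj
      obtain ⟨p, hp, p', hp', hs, hpp⟩ := hinj
      refine ⟨p, hp, p', hp', fun he => hpp (Prod.ext he hs), ?_⟩
      rw [hs, dist_self]
      simpa using hd
  refine ⟨dist p.2 p'.2, hdist, ?_⟩
  have b1 := pow_le_sum_min hq h0 h1 a p.2 p'.2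
  have b2 := sum_min_le_msgError_add h0 h1 c dec hne
  rw [(hF p hp).2, (hF p' hp').2] at b2
  have b3 : msgError q ε c dec p.1 ≤ 2 * avgError q ε c dec := (mem_filter.1 (hF p hp).1).2
  have b4 : msgError q ε c dec p'.1 ≤ 2 * avgError q ε c dec := (mem_filter.1 (hF p' hp').1).2
  linarith

end Channel

end Typewriter

/-! ### Optimization over the parameters and passage to the limit. -/

namespace Typewriter

open Filter Topology

theorem continuous_lp2Fun : Continuous lp2Fun := by
  unfold lp2Fun
  refine Continuous.div (by fun_prop) (by fun_prop) (fun p => ?_)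
  have := Real.sqrt_nonneg (p.2 * (1 - p.2))
  linarith

theorem continuous_h2 : Continuous h2 := Real.binEntropy_continuous.div_const _

theorem h2_lt_h2 {x y : ℝ} (hx : 0 ≤ x) (hxy : x < y) (hy : y ≤ 1 / 2) : h2 x < h2 y := by
  refine div_lt_div_of_pos_right (Real.binEntropy_strictMonoOn ⟨hx, ?_⟩ ⟨hx.trans hxy.le, ?_⟩ hxy)
    (Real.log_pos one_lt_two) <;> norm_num at hy ⊢ <;> linarith

theorem h2_half : h2 (1 / 2) = 1 := by
  rw [h2, one_div, Real.binEntropy_two_inv, div_self (Real.log_pos one_lt_two).ne']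

theorem h2_zero : h2 0 = 0 := by simp [h2]

/-- The minimum in `deltaLP2` is approached by interior points of the region. -/
theorem exists_lp2Fun_lt {r : ℝ} (hr : 0 < r) {B : ℝ} (hB : deltaLP2 r < B) :
    ∃ a b : ℝ, 0 < b ∧ b < a ∧ a ≤ 1 / 2 ∧ 1 - h2 a + h2 b < r ∧ lp2Fun (a, b) < B := by
  obtain ⟨⟨⟨a, b⟩, ⟨hb0, hba, ha, hreg⟩, hval⟩, -⟩ := isLeast_deltaLP2 r hr.le
  simp only at hb0 hba ha hreg
  rw [← hval] at hB
  obtain ⟨a', b', hb', hba', ha', hreg', hB'⟩ : ∃ a b : ℝ, 0 ≤ b ∧ b < a ∧ a ≤ 1 / 2 ∧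
      1 - h2 a + h2 b < r ∧ lp2Fun (a, b) < B := by
    -- First make the constraint strict: decrease `b` if it is positive, otherwise increase `a`; at
    -- `(1 / 2, 0)` the hypothesis `0 < r` already gives slack. That slack then permits raising `b`
    -- above zero.
    rcases hb0.eq_or_lt with rfl | hbpos
    · rcases ha.eq_or_lt with rfl | ha
      · refine ⟨1 / 2, 0, le_rfl, by norm_num, le_rfl, ?_, hB⟩
        rw [h2_half, h2_zero]
        linarith
      · have hc : Continuous fun x : ℝ => lp2Fun (x, 0) := continuous_lp2Fun.comp (by fun_prop)
        have e1 : ∀ᶠ x in 𝓝[>] a, lp2Fun (x, 0) < B :=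
          (hc.tendsto a).eventually_lt_const hB |>.filter_mono nhdsWithin_le_nhds
        have e2 : ∀ᶠ x in 𝓝[>] a, x < 1 / 2 :=
          (eventually_lt_nhds ha).filter_mono nhdsWithin_le_nhds
        obtain ⟨x, h1, h2', h3⟩ := (e1.and (e2.and self_mem_nhdsWithin)).exists
        have h3 : a < x := h3
        have := h2_lt_h2 hba h3 h2'.le
        exact ⟨x, 0, le_rfl, by linarith, h2'.le, by linarith, h1⟩
    · have hc : Continuous fun x : ℝ => lp2Fun (a, x) := continuous_lp2Fun.comp (by fun_prop)
      have e1 : ∀ᶠ x in 𝓝[<] b, lp2Fun (a, x) < B :=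
        (hc.tendsto b).eventually_lt_const hB |>.filter_mono nhdsWithin_le_nhds
      have e2 : ∀ᶠ x in 𝓝[<] b, 0 < x :=
        (eventually_gt_nhds hbpos).filter_mono nhdsWithin_le_nhds
      obtain ⟨x, h1, h2', h3⟩ := (e1.and (e2.and self_mem_nhdsWithin)).exists
      have h3 : x < b := h3
      have := h2_lt_h2 h2'.le h3 (hba.trans ha)
      exact ⟨a, x, h2'.le, by linarith, ha, by linarith, h1⟩
  have hc : Continuous fun x : ℝ => lp2Fun (a', x) := continuous_lp2Fun.comp (by fun_prop)
  have hc2 : Continuous fun x : ℝ => 1 - h2 a' + h2 x := continuous_const.add continuous_h2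
  have e1 : ∀ᶠ x in 𝓝[>] b', lp2Fun (a', x) < B :=
    (hc.tendsto b').eventually_lt_const hB' |>.filter_mono nhdsWithin_le_nhds
  have e2 : ∀ᶠ x in 𝓝[>] b', 1 - h2 a' + h2 x < r :=
    (hc2.tendsto b').eventually_lt_const hreg' |>.filter_mono nhdsWithin_le_nhds
  have e3 : ∀ᶠ x in 𝓝[>] b', x < a' := (eventually_lt_nhds hba').filter_mono nhdsWithin_le_nhds
  obtain ⟨x, h1, h2', h3, h4⟩ := (e1.and (e2.and (e3.and self_mem_nhdsWithin))).exists
  exact ⟨a', x, lt_of_le_of_lt hb' h4, h3, ha', h2', h1⟩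

theorem eventually_quadratic_lt_exp {γ : ℝ} (hγ : 0 < γ) (T : ℝ) :
    ∀ᶠ n : ℕ in atTop, 2 * ((n + 1) * (n * T + 1)) < Real.exp (n * γ) := by
  have hr : |Real.exp (-γ)| < 1 := by
    rw [abs_of_pos (Real.exp_pos _), Real.exp_lt_one_iff]
    linarith
  have t := fun k => tendsto_pow_const_mul_const_pow_of_abs_lt_one k hr
  have := (((t 2).const_mul (2 * T)).add (((t 1).const_mul (2 * (T + 1))).add
    ((t 0).const_mul 2)))
  simp only [mul_zero, add_zero] at this
  filter_upwards [this.eventually_lt_const one_pos] with n hn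
  have e : Real.exp (-γ) ^ n * Real.exp (n * γ) = 1 := by
    rw [← Real.exp_nat_mul, ← Real.exp_add]
    simp
  have hp := Real.exp_pos (n * γ)
  have := mul_lt_mul_of_pos_right hn hp
  rw [one_mul] at this
  refine lt_of_eq_of_lt ?_ this
  linear_combination (-(2 * T * n ^ 2 + 2 * (T + 1) * n + 2)) * e

/-- For large `n`, the codes of rate `R` are larger than the linear programming bound allows. -/
theorem eventually_lt_card {q : ℕ} (hq : 4 ≤ q) {R a b : ℝ} (hb0 : 0 < b) (hba : b < a)
    (ha : a ≤ 1 / 2) (hR : 1 - h2 a + h2 b < R - Real.logb 2 ((q : ℝ) / 2)) {T : ℝ} (hT : 0 < T) :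
    ∀ᶠ n : ℕ in atTop,
      2 * ((q : ℝ) ^ n * ((n * T + 1) *
        ∑ k ∈ Finset.range (⌊b * n⌋₊ + 1), (n.choose k : ℝ))) <
      ⌈(2 : ℝ) ^ ((n : ℝ) * R)⌉₊ * n.choose ⌊a * n⌋₊ := by
  have hl2 : 0 < Real.log 2 := Real.log_pos one_lt_two
  have hqr : (0 : ℝ) < q := by positivity
  -- `γ` is the natural-log exponential gap between the two sides. Half of it absorbs the error in
  -- `⌊a * n⌋₊ / n → a`, the other half the polynomial factors.
  set γ := R * Real.log 2 + Real.binEntropy a - Real.binEntropy b - Real.log q with hγdef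
  have hγ : 0 < γ := by
    rw [Real.logb, Real.log_div hqr.ne' two_ne_zero, h2, h2] at hR
    have := mul_lt_mul_of_pos_right hR hl2
    have e1 : (1 - Real.binEntropy a / Real.log 2 + Real.binEntropy b / Real.log 2) * Real.log 2 =
        Real.log 2 - Real.binEntropy a + Real.binEntropy b := by field_simp
    have e2 : (R - (Real.log q - Real.log 2) / Real.log 2) * Real.log 2 =
        R * Real.log 2 - Real.log q + Real.log 2 := by field_simp; ring
    rw [e1, e2] at this
    linarith
  have hent : Tendsto (fun n : ℕ => Real.binEntropy ((⌊a * n⌋₊ : ℝ) / n)) atTop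
      (𝓝 (Real.binEntropy a)) :=
    (Real.binEntropy_continuous.tendsto a).comp
      (Johnson.tendsto_floor_mul_div a (hb0.trans hba).le)
  have ha0 : 0 < a := hb0.trans hba
  have hfl : Tendsto (fun n : ℕ => ⌊a * n⌋₊) atTop atTop :=
    tendsto_nat_floor_atTop.comp (tendsto_natCast_atTop_atTop.const_mul_atTop ha0)
  filter_upwards [hent.eventually_const_lt (by linarith : Real.binEntropy a - γ / 2 < _),
    eventually_quadratic_lt_exp (half_pos hγ) T, hfl.eventually_gt_atTop 0,
    eventually_gt_atTop 0] with n h1 h2' h3 h4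
  have hn : (0 : ℝ) < n := by exact_mod_cast h4
  have hw : ⌊a * n⌋₊ < n := by
    have := Nat.floor_le (by positivity : 0 ≤ a * n)
    have h5 : (⌊a * n⌋₊ : ℝ) < n := by nlinarith
    exact_mod_cast h5
  have hS := Johnson.sum_choose_le_exp (n := n) hb0 (by linarith) (Nat.floor_le (by positivity))
  have hC := Johnson.exp_le_choose h3 hw
  have hM : Real.exp (n * (R * Real.log 2)) ≤ ⌈(2 : ℝ) ^ ((n : ℝ) * R)⌉₊ := by
    refine le_trans (le_of_eq ?_) (Nat.le_ceil _)
    rw [Real.rpow_def_of_pos two_pos]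
    congr 1
    ring
  have hqn : (q : ℝ) ^ n = Real.exp (n * Real.log q) := by
    rw [Real.exp_nat_mul, Real.exp_log hqr]
  have hMC : Real.exp (n * (R * Real.log 2)) * Real.exp (n * (Real.binEntropy a - γ / 2)) ≤
      ⌈(2 : ℝ) ^ ((n : ℝ) * R)⌉₊ * ((n + 1) * n.choose ⌊a * n⌋₊) := by
    refine mul_le_mul hM (le_trans (Real.exp_le_exp.2 ?_) hC) (Real.exp_pos _).le (by positivity)
    exact mul_le_mul_of_nonneg_left h1.le hn.le
  have hlhs : (q : ℝ) ^ n * ((n * T + 1) *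
      ∑ k ∈ Finset.range (⌊b * n⌋₊ + 1), (n.choose k : ℝ)) ≤
      (n * T + 1) * (Real.exp (n * Real.log q) * Real.exp (n * Real.binEntropy b)) := by
    rw [hqn]
    have := mul_le_mul_of_nonneg_left hS
      (by positivity : 0 ≤ (n * T + 1) * Real.exp (n * Real.log q))
    linarith
  have e : Real.exp (n * (R * Real.log 2)) * Real.exp (n * (Real.binEntropy a - γ / 2)) =
      Real.exp (n * (γ / 2)) * (Real.exp (n * Real.log q) * Real.exp (n * Real.binEntropy b)) := by
    rw [← Real.exp_add, ← Real.exp_add, ← Real.exp_add]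
    congr 1
    rw [hγdef]
    ring
  set Y := Real.exp (n * Real.log q) * Real.exp (n * Real.binEntropy b)
  have hY : 0 < Y := by positivity
  have := mul_lt_mul_of_pos_right h2' hY
  have hn1 : (0 : ℝ) < n + 1 := by positivity
  refine lt_of_mul_lt_mul_left ?_ hn1.le
  have := mul_le_mul_of_nonneg_left hlhs hn1.le
  linarith

theorem eventually_exponent_le {q : ℕ} [NeZero q] (hq : 4 ≤ q) {ε : ℝ} (h0 : 0 < ε)
    (h1 : ε ≤ 1 / 2) {R : ℝ} (hR : Real.logb 2 ((q : ℝ) / 2) < R) {η : ℝ} (hη : 0 < η) :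
    ∀ᶠ n : ℕ in atTop, exponent (minError q ε ⌈(2 : ℝ) ^ ((n : ℝ) * R)⌉₊ n) n ≤
      (((deltaLP2 (R - Real.logb 2 ((q : ℝ) / 2)) + η) * Real.logb 2 (1 / alphaEps ε) + η : ℝ) :
        EReal) := by
  set δ := deltaLP2 (R - Real.logb 2 ((q : ℝ) / 2))
  obtain ⟨a, b, hb0, hba, ha, hreg, hlt⟩ := exists_lp2Fun_lt (sub_pos.2 hR)
    (lt_add_of_pos_right δ hη)
  -- The halving passes from Hamming to Johnson distance.
  set T := (δ + η) / 2
  have hT : (a * (1 - a) - b * (1 - b)) / (1 + 2 * √(b * (1 - b))) < T := by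
    have : lp2Fun (a, b) = 2 * ((a * (1 - a) - b * (1 - b)) / (1 + 2 * √(b * (1 - b)))) := by
      simp only [lp2Fun]; ring
    rw [this] at hlt
    simp only [T]
    linarith
  have hT0 : 0 < T := by
    refine lt_of_le_of_lt ?_ hT
    exact div_nonneg (by nlinarith) (by positivity)
  have hα : 0 < alphaEps ε := Real.sqrt_pos.2 (mul_pos h0 (by linarith))
  have hα1 : alphaEps ε ≤ 1 := Real.sqrt_le_one.2 (by nlinarith)
  set ℓ := Real.logb 2 (1 / alphaEps ε) with hℓdef
  have hℓ : 0 ≤ ℓ := Real.logb_nonneg one_lt_two (by rw [le_div_iff₀ hα]; linarith)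
  have hsmall : ∀ᶠ n : ℕ in atTop, (2 + 2 * ℓ) / n < η :=
    (tendsto_const_div_atTop_nhds_zero_nat (2 + 2 * ℓ)).eventually_lt_const hη
  filter_upwards [Johnson.eventually_card_code_le hb0 hba ha hT,
    eventually_lt_card hq hb0 hba ha hreg hT0, hsmall, eventually_gt_atTop 0] with n c1 c2 c3 hn
  have hnr : (0 : ℝ) < n := by exact_mod_cast hn
  have hM : 1 ≤ ⌈(2 : ℝ) ^ ((n : ℝ) * R)⌉₊ :=
    Nat.ceil_pos.2 (Real.rpow_pos_of_pos two_pos _)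
  obtain ⟨c, dec, hP⟩ := exists_avgError_eq_minError q ε _ n hM
  obtain ⟨j, hj, hpow⟩ := exists_pow_le_avgError hq h0 h1 hM c dec
    (by positivity : 0 < n * T + 1) c1 c2
  rw [hP] at hpow
  set P := minError q ε ⌈(2 : ℝ) ^ ((n : ℝ) * R)⌉₊ n
  have hpp : 0 < alphaEps ε ^ (2 * j) := pow_pos hα _
  have hPpos : 0 < P := by linarith
  rw [exponent, if_neg hPpos.ne', EReal.coe_le_coe_iff]
  have hlog : Real.logb 2 (1 / P) ≤ 2 + 2 * j * ℓ := by
    have e : 2 + 2 * j * ℓ = Real.logb 2 (4 / alphaEps ε ^ (2 * j)) := by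
      rw [hℓdef, Real.logb_div (by norm_num) hpp.ne', Real.logb_pow, one_div, Real.logb_inv,
        show (4 : ℝ) = 2 ^ 2 by norm_num, Real.logb_pow, Real.logb_self_eq_one one_lt_two]
      push_cast
      ring
    rw [e]
    refine Real.logb_le_logb_of_le one_lt_two (by positivity) ?_
    rw [div_le_div_iff₀ hPpos hpp]
    linarith
  have hj2 : 2 * j * ℓ ≤ 2 * (n * T + 1) * ℓ :=
    mul_le_mul_of_nonneg_right (by linarith) hℓ
  have e : (1 / (n : ℝ)) * (2 + 2 * (n * T + 1) * ℓ) = (δ + η) * ℓ + (2 + 2 * ℓ) / n := by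
    simp only [T]
    field_simp
    ring
  have := mul_le_mul_of_nonneg_left (hlog.trans (add_le_add_right hj2 2))
    (by positivity : 0 ≤ 1 / (n : ℝ))
  linarith

end Typewriter

theorem theorem4 (q : ℕ) [NeZero q] (hq : 4 ≤ q) (ε : ℝ) (hε0 : 0 < ε) (hε1 : ε ≤ 1 / 2)
    (R : ℝ) (hR : Real.logb 2 ((q : ℝ) / 2) < R) :
    Typewriter.reliability q ε R ≤
      ((Typewriter.deltaLP2 (R - Real.logb 2 ((q : ℝ) / 2)) *
        Real.logb 2 (1 / Typewriter.alphaEps ε) : ℝ) : EReal) := by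
  set δ := Typewriter.deltaLP2 (R - Real.logb 2 ((q : ℝ) / 2))
  set ℓ := Real.logb 2 (1 / Typewriter.alphaEps ε)
  have hℓ : 0 ≤ ℓ := by
    have hα : 0 < Typewriter.alphaEps ε := Real.sqrt_pos.2 (mul_pos hε0 (by linarith))
    have hα1 : Typewriter.alphaEps ε ≤ 1 := Real.sqrt_le_one.2 (by nlinarith)
    exact Real.logb_nonneg one_lt_two (by rw [le_div_iff₀ hα]; linarith)
  by_contra hc
  obtain ⟨x, hx1, hx2⟩ := EReal.lt_iff_exists_real_btwn.1 (not_le.1 hc)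
  rw [EReal.coe_lt_coe_iff] at hx1
  -- This `η` solves `(δ + η) * ℓ + η = x`; the denominator stays positive because `ℓ ≥ 0`.
  have hη : 0 < (x - δ * ℓ) / (ℓ + 1) := div_pos (by linarith) (by linarith)
  have hev := Typewriter.eventually_exponent_le hq hε0 hε1 hR hη
  have e : (δ + (x - δ * ℓ) / (ℓ + 1)) * ℓ + (x - δ * ℓ) / (ℓ + 1) = x := by
    have : ℓ + 1 ≠ 0 := by linarith
    field_simp
    ring
  rw [e] at hev
  exact absurd (Filter.limsup_le_of_le (by isBoundedDefault) hev) (not_le.2 hx2)
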